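/- Let $n\ge 7$ and $k\ge 2$ be integers. Put $i'=n-i+1$ and let $\mathfrak g=\mathfrak{so}_n\subset\mathfrak{gl}_n(\mathbb C)$ be the orthogonal Lie algebra spanned by the elements $F_{ij}=E_{ij}-E_{j'i'}$, $1\le i,j\le n$. Define $\Phi_{2k}\in\mathcal S^{2k}(\mathfrak g)$ as the coefficients of the formal power series $$\det\big(I_n-q(F_{ij})\big)^{-1}=1+\Phi_2q^2+\Phi_4q^4+\ldots+\Phi_{2k}q^{2k}+\ldots$$ with coefficients in the symmetric algebra $\mathcal S(\mathfrak g)$. For $d\ge 1$ embed $\mathcal S^d(\mathfrak g)$ in $\mathfrak g^{\otimes d}$ by the symmetrisation map $\varpi(y_1\cdots y_d)=\frac1{d!}\sum_{\sigma\in S_d}y_{\sigma(1)}\otimes\cdots\otimes y_{\sigma(d)}$. For $d\ge 3$ let ${\sf m}\colon\mathcal S^d(\mathfrak g)\to\mathfrak{gl}(\mathfrak g)\otimes\mathfrak g^{\otimes(d-3)}$ be the composition of $\varpi$ with the linear map $$y_1\otimes\cdots\otimes y_d\mapsto \mathrm{ad}(y_1)\mathrm{ad}(y_2)\mathrm{ad}(y_3)\otimes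 y_4\otimes\cdots\otimes y_d ,$$ and regard $\mathcal S^{d-2}(\mathfrak g)\subset\mathfrak g\otimes\mathfrak g^{\otimes(d-3)}$ as a subspace of $\mathfrak{gl}(\mathfrak g)\otimes\mathfrak g^{\otimes(d-3)}$ via $\varpi$ followed by $\mathrm{ad}\otimes\mathrm{id}$. Then $${\sf m}(\Phi_{2k})=R(k)\,\Phi_{2k-2},\qquad R(k)=\frac{1}{k(2k-1)}\left(\binom n2+2n(k-1)+(k-1)(2k-3)\right).$$ -/

import Mathlib

open scoped TensorProduct
open Equiv (Perm)

noncomputable section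

namespace SymmetrisationMap

section General

variable (L : Type*) [AddCommGroup L] [Module ℂ L]

/-- The symmetrising multilinear map
`(y₁, …, y_d) ↦ (1/d!) ∑_σ y_{σ(1)} ⊗ ⋯ ⊗ y_{σ(d)}` with values in the tensor algebra. -/
def symMultilinear (d : ℕ) : MultilinearMap ℂ (fun _ : Fin d => L) (TensorAlgebra ℂ L) :=
  ((d.factorial : ℂ)⁻¹) • ∑ σ : Perm (Fin d), (TensorAlgebra.tprod ℂ L d).domDomCongr σ

/-- The symmetrising projection of the tensor algebra `⨁_d L^{⊗ d}`, degree by degree. -/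
def symProj : TensorAlgebra ℂ L →ₗ[ℂ] TensorAlgebra ℂ L :=
  (DirectSum.toModule ℂ ℕ (TensorAlgebra ℂ L)
      (fun d => PiTensorProduct.lift (symMultilinear L d))) ∘ₗ
    (TensorAlgebra.equivDirectSum (R := ℂ) (M := L)).toLinearMap

theorem symProj_tprod (d : ℕ) (y : Fin d → L) :
    symProj L (TensorAlgebra.tprod ℂ L d y) =
      ((d.factorial : ℂ)⁻¹) • ∑ σ : Perm (Fin d), TensorAlgebra.tprod ℂ L d (y ∘ σ) := by
  have h : (TensorAlgebra.equivDirectSum (R := ℂ) (M := L)) (TensorAlgebra.tprod ℂ L d y) =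
      DirectSum.of (fun d => ⨂[ℂ]^d L) d (PiTensorProduct.tprod ℂ y) :=
    TensorAlgebra.toDirectSum_tensorPower_tprod y
  simp only [symProj, LinearMap.comp_apply, AlgEquiv.toLinearMap_apply, h]
  erw [DirectSum.toModule_lof]
  simp [symMultilinear, Function.comp_def]

/-- The tensor algebra is spanned by the products of vectors. -/
theorem span_prod :
    Submodule.span ℂ {t : TensorAlgebra ℂ L | ∃ l : List L, t = (l.map (TensorAlgebra.ι ℂ)).prod} =
      ⊤ := by
  rw [eq_top_iff]
  rintro t -
  induction t using TensorAlgebra.induction with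
  | algebraMap r =>
    rw [Algebra.algebraMap_eq_smul_one]
    exact Submodule.smul_mem _ _ (Submodule.subset_span ⟨[], by simp⟩)
  | ι x => exact Submodule.subset_span ⟨[x], by simp⟩
  | mul a b ha hb =>
    induction ha, hb using Submodule.span_induction₂ with
    | mem_mem x y hx hy =>
      obtain ⟨l, rfl⟩ := hx
      obtain ⟨l', rfl⟩ := hy
      exact Submodule.subset_span ⟨l ++ l', by simp⟩
    | zero_left y hy => simp
    | zero_right x hx => simp
    | add_left x y z _ _ _ h h' => rw [add_mul]; exact Submodule.add_mem _ h h'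
    | add_right x y z _ _ _ h h' => rw [mul_add]; exact Submodule.add_mem _ h h'
    | smul_left r x y _ _ h => rw [smul_mul_assoc]; exact Submodule.smul_mem _ r h
    | smul_right r x y _ _ h => rw [mul_smul_comm]; exact Submodule.smul_mem _ r h
  | add a b ha hb => exact Submodule.add_mem _ ha hb

theorem symProj_tprod_comp (d : ℕ) (y : Fin d → L) (τ : Perm (Fin d)) :
    symProj L (TensorAlgebra.tprod ℂ L d (y ∘ τ)) = symProj L (TensorAlgebra.tprod ℂ L d y) := by
  rw [symProj_tprod, symProj_tprod]
  congr 1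
  exact Fintype.sum_equiv (Equiv.mulLeft τ) _ _ (fun σ => by
    simp [Function.comp_def])

theorem symProj_list_swap (l₁ l₂ : List L) (x z : L) :
    symProj L ((l₁ ++ x :: z :: l₂).map (TensorAlgebra.ι ℂ)).prod =
      symProj L ((l₁ ++ z :: x :: l₂).map (TensorAlgebra.ι ℂ)).prod := by
  set l := l₁ ++ x :: z :: l₂ with hl
  have hlen : l.length = l₁.length + l₂.length + 2 := by simp [hl]; omega
  let i : Fin l.length := ⟨l₁.length, by omega⟩
  let j : Fin l.length := ⟨l₁.length + 1, by omega⟩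
  have h1 : (l.map (TensorAlgebra.ι ℂ)).prod = TensorAlgebra.tprod ℂ L l.length l.get := by
    rw [TensorAlgebra.tprod_apply]
    congr 1
    apply List.ext_getElem <;> simp
  have h2 : ((l₁ ++ z :: x :: l₂).map (TensorAlgebra.ι ℂ)).prod =
      TensorAlgebra.tprod ℂ L l.length (l.get ∘ Equiv.swap i j) := by
    rw [TensorAlgebra.tprod_apply]
    congr 1
    apply List.ext_getElem
    · simp only [List.length_map, List.length_append, List.length_cons, List.length_ofFn]
      omega
    · intro m hm hm'
      simp only [List.getElem_map, List.getElem_ofFn, Function.comp_apply, List.get_eq_getElem]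
      congr 1
      by_cases hmi : m = l₁.length
      · subst hmi
        have : Equiv.swap i j ⟨l₁.length, by omega⟩ = j := Equiv.swap_apply_left i j
        rw [this]
        simp [j, hl]
      · by_cases hmj : m = l₁.length + 1
        · subst hmj
          have : Equiv.swap i j ⟨l₁.length + 1, by omega⟩ = i := Equiv.swap_apply_right i j
          rw [this]
          simp [i, hl]
        · rw [Equiv.swap_apply_of_ne_of_ne (by simpa [i] using hmi) (by simpa [j] using hmj)]
          simp only [hl]
          grind
  rw [h1, h2, symProj_tprod_comp]

theorem symProj_swap (u v : TensorAlgebra ℂ L) (x y : L) :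
    symProj L (u * (TensorAlgebra.ι ℂ x * TensorAlgebra.ι ℂ y) * v) =
      symProj L (u * (TensorAlgebra.ι ℂ y * TensorAlgebra.ι ℂ x) * v) := by
  have hu : u ∈ Submodule.span ℂ
      {t : TensorAlgebra ℂ L | ∃ l : List L, t = (l.map (TensorAlgebra.ι ℂ)).prod} := by
    rw [span_prod]; trivial
  have hv : v ∈ Submodule.span ℂ
      {t : TensorAlgebra ℂ L | ∃ l : List L, t = (l.map (TensorAlgebra.ι ℂ)).prod} := by
    rw [span_prod]; trivial
  induction hu, hv using Submodule.span_induction₂ with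
  | mem_mem a b ha hb =>
    obtain ⟨l, rfl⟩ := ha
    obtain ⟨l', rfl⟩ := hb
    simpa [mul_assoc] using symProj_list_swap L l l' x y
  | zero_left y hy => simp
  | zero_right x hx => simp
  | add_left x y z _ _ _ h h' => simp only [add_mul, map_add, h, h']
  | add_right x y z _ _ _ h h' => simp only [mul_add, map_add, h, h']
  | smul_left r x y _ _ h => simp only [smul_mul_assoc, map_smul, h]
  | smul_right r x y _ _ h => simp only [mul_smul_comm, map_smul, h]

theorem symProj_eq_of_rel {a b : TensorAlgebra ℂ L} (h : TensorAlgebra.symRingCon ℂ L a b) :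
    symProj L a = symProj L b := by
  let c : RingCon (TensorAlgebra ℂ L) :=
    { r := fun a b => ∀ u v, symProj L (u * a * v) = symProj L (u * b * v)
      iseqv := ⟨fun _ _ _ => rfl, fun h u v => (h u v).symm,
        fun h h' u v => (h u v).trans (h' u v)⟩
      mul' := fun {w x y z} h h' u v => by
        have e1 := h u (y * v)
        have e2 := h' (u * x) v
        simp only [mul_assoc] at e1 e2 ⊢
        exact e1.trans e2
      add' := fun {w x y z} h h' u v => by
        simp only [mul_add, add_mul, map_add, h u v, h' u v] }
  have hc : TensorAlgebra.symRingCon ℂ L ≤ c := by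
    unfold TensorAlgebra.symRingCon
    refine RingCon.ringConGen_le.2 ?_
    rintro _ _ ⟨x, y⟩ u v
    exact symProj_swap L u v x y
  simpa using hc h 1 1

/-- The symmetrisation map `ϖ : S(L) → ⨁_d L^{⊗ d}`. -/
def symmetrisation : SymmetricAlgebra ℂ L →ₗ[ℂ] TensorAlgebra ℂ L :=
  (Submodule.liftQ (LinearMap.ker (SymmetricAlgebra.algHom ℂ L).toLinearMap) (symProj L)
      (fun a ha => by
        have h : SymmetricAlgebra.algHom ℂ L a = SymmetricAlgebra.algHom ℂ L 0 := by
          simpa using ha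
        simpa using symProj_eq_of_rel L ((RingCon.eq _).1 h))) ∘ₗ
    (LinearMap.quotKerEquivOfSurjective (SymmetricAlgebra.algHom ℂ L).toLinearMap
      (SymmetricAlgebra.algHom_surjective ℂ L)).symm.toLinearMap

/-- `ϖ(y₁ ⋯ y_d) = (1/d!) ∑_σ y_{σ(1)} ⊗ ⋯ ⊗ y_{σ(d)}`. -/
theorem symmetrisation_prod (d : ℕ) (y : Fin d → L) :
    symmetrisation L (∏ i, SymmetricAlgebra.ι ℂ L (y i)) =
      ((d.factorial : ℂ)⁻¹) • ∑ σ : Perm (Fin d), TensorAlgebra.tprod ℂ L d (y ∘ σ) := by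
  have h : ∏ i, SymmetricAlgebra.ι ℂ L (y i) =
      SymmetricAlgebra.algHom ℂ L (TensorAlgebra.tprod ℂ L d y) := by
    rw [TensorAlgebra.tprod_apply, map_list_prod, List.map_ofFn, List.prod_ofFn]
    rfl
  have h' : (LinearMap.quotKerEquivOfSurjective (SymmetricAlgebra.algHom ℂ L).toLinearMap
      (SymmetricAlgebra.algHom_surjective ℂ L)).symm
        (SymmetricAlgebra.algHom ℂ L (TensorAlgebra.tprod ℂ L d y)) =
      Submodule.Quotient.mk (TensorAlgebra.tprod ℂ L d y) := by
    rw [LinearEquiv.symm_apply_eq]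
    rfl
  rw [h, symmetrisation, LinearMap.comp_apply, LinearEquiv.coe_coe, h', Submodule.liftQ_apply,
    symProj_tprod]

end General

section Lie

variable (L : Type*) [LieRing L] [LieAlgebra ℂ L]

/-- Left multiplication by `y` on `⨁_d L^{⊗ d}`, together with the map `t ↦ ad(y) ⊗ t` into
`𝔤𝔩(L) ⊗ ⨁_d L^{⊗ d}`, as one operator on the sum of the two spaces. -/
def headOperator : L →ₗ[ℂ] Module.End ℂ
    (TensorAlgebra ℂ L × (Module.End ℂ L ⊗[ℂ] TensorAlgebra ℂ L)) where
  toFun y :=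
    (LinearMap.prod (LinearMap.mulLeft ℂ (TensorAlgebra.ι ℂ y))
      (TensorProduct.mk ℂ (Module.End ℂ L) (TensorAlgebra ℂ L) (LieAlgebra.ad ℂ L y))) ∘ₗ
        LinearMap.fst ℂ _ _
  map_add' x y := by ext <;> simp [add_mul]
  map_smul' r x := by ext <;> simp [TensorProduct.smul_tmul']

/-- The linear map `y₁ ⊗ y₂ ⊗ ⋯ ⊗ y_d ↦ ad(y₁) ⊗ (y₂ ⊗ ⋯ ⊗ y_d)` from `L^{⊗ d}` to
`𝔤𝔩(L) ⊗ L^{⊗ (d-1)}` for `d ≥ 1`; it is zero on scalars. -/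
def adHead : TensorAlgebra ℂ L →ₗ[ℂ] Module.End ℂ L ⊗[ℂ] TensorAlgebra ℂ L :=
  LinearMap.snd ℂ _ _ ∘ₗ LinearMap.applyₗ (1, 0) ∘ₗ
    (TensorAlgebra.lift ℂ (headOperator L)).toLinearMap

/-- The linear map `𝗆_r`, sending `y₁ ⊗ ⋯ ⊗ y_d` to
`ad(y₁) ⋯ ad(y_r) ⊗ (y_{r+1} ⊗ ⋯ ⊗ y_d)` for `d ≥ r`, and to zero for `d < r`. -/
def mTensor : ℕ → (TensorAlgebra ℂ L →ₗ[ℂ] Module.End ℂ L ⊗[ℂ] TensorAlgebra ℂ L)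
  | 0 => TensorProduct.mk ℂ (Module.End ℂ L) (TensorAlgebra ℂ L) 1
  | r + 1 =>
    (LinearMap.rTensor (TensorAlgebra ℂ L) (LinearMap.mul' ℂ (Module.End ℂ L)) ∘ₗ
      (TensorProduct.assoc ℂ (Module.End ℂ L) (Module.End ℂ L) (TensorAlgebra ℂ L)).symm.toLinearMap ∘ₗ
        LinearMap.lTensor (Module.End ℂ L) (adHead L)) ∘ₗ mTensor r

theorem adHead_one : adHead L 1 = 0 := by
  simp [adHead]

theorem lift_headOperator_fst (t : TensorAlgebra ℂ L)
    (p : TensorAlgebra ℂ L × (Module.End ℂ L ⊗[ℂ] TensorAlgebra ℂ L)) :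
    (TensorAlgebra.lift ℂ (headOperator L) t p).1 = t * p.1 := by
  induction t using TensorAlgebra.induction generalizing p with
  | algebraMap r => simp [Algebra.algebraMap_eq_smul_one]
  | ι x => simp [headOperator]
  | mul a b ha hb => simp [ha, hb, mul_assoc]
  | add a b ha hb => simp [ha, hb, add_mul]

theorem adHead_ι_mul (y : L) (t : TensorAlgebra ℂ L) :
    adHead L (TensorAlgebra.ι ℂ y * t) = LieAlgebra.ad ℂ L y ⊗ₜ[ℂ] t := by
  have := lift_headOperator_fst L t (1, 0)
  simp [adHead, headOperator] at this ⊢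
  rw [this]

theorem mTensor_append (l l' : List L) :
    mTensor L l.length ((l ++ l').map (TensorAlgebra.ι ℂ)).prod =
      (l.map (LieAlgebra.ad ℂ L)).prod ⊗ₜ[ℂ] (l'.map (TensorAlgebra.ι ℂ)).prod := by
  induction l using List.reverseRecOn generalizing l' with
  | nil => simp [mTensor]
  | append_singleton l y ih =>
    have := ih (y :: l')
    rw [List.length_append, List.length_singleton, mTensor, LinearMap.comp_apply,
      List.append_assoc, List.singleton_append, this]
    simp [adHead_ι_mul]

theorem mTensor_of_lt (r : ℕ) (l : List L) (h : l.length < r) :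
    mTensor L r (l.map (TensorAlgebra.ι ℂ)).prod = 0 := by
  induction r with
  | zero => omega
  | succ r ih =>
    rw [mTensor, LinearMap.comp_apply]
    rcases Nat.lt_or_ge l.length r with h' | h'
    · rw [ih h', map_zero]
    · obtain rfl : r = l.length := by omega
      have := mTensor_append L l []
      rw [List.append_nil] at this
      rw [this]
      simp [adHead_one]

/-- The map `𝗆 : S^d(L) → L^{⊗ d} → 𝔤𝔩(L) ⊗ L^{⊗ (d-3)}`: symmetrise, then replace the first three
tensor factors by the product of their adjoint operators. It is zero on `S^d(L)` for `d ≤ 2`. -/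
def mMap : SymmetricAlgebra ℂ L →ₗ[ℂ] Module.End ℂ L ⊗[ℂ] TensorAlgebra ℂ L :=
  mTensor L 3 ∘ₗ symmetrisation L

/-- The embedding by which, for `e ≥ 1`, elements of `S^e(L)` are viewed as elements of
`𝔤𝔩(L) ⊗ L^{⊗ (e-1)}`: symmetrise, `S^e(L) ⊂ L ⊗ L^{⊗ (e-1)}`, and let the first tensor factor act on
`L` by the adjoint representation. -/
def symEmbedding : SymmetricAlgebra ℂ L →ₗ[ℂ] Module.End ℂ L ⊗[ℂ] TensorAlgebra ℂ L :=
  adHead L ∘ₗ symmetrisation L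

end Lie

section Orthogonal

attribute [local instance 100] LieRing.ofAssociativeRing

/-- The matrix of the symmetric bilinear form `(e_i, e_{j'}) = δ_{ij}`, where `i' = n - i + 1`. -/
def antidiagonal (n : ℕ) : Matrix (Fin n) (Fin n) ℂ :=
  Matrix.of fun i j => if i = j.rev then 1 else 0

/-- The orthogonal Lie algebra `𝔰𝔬_n ⊂ 𝔤𝔩_n`: the complex matrices that are skew-adjoint for the
form with the antidiagonal Gram matrix. -/
abbrev so (n : ℕ) : LieSubalgebra ℂ (Matrix (Fin n) (Fin n) ℂ) :=
  skewAdjointMatricesLieSubalgebra (antidiagonal n)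

/-- A matrix `A` is in `𝔰𝔬_n` if and only if `A_{ij} = -A_{j'i'}` for all `i, j`. -/
theorem mem_so_iff (n : ℕ) (A : Matrix (Fin n) (Fin n) ℂ) :
    A ∈ so n ↔ ∀ i j, A i j = -A j.rev i.rev := by
  rw [mem_skewAdjointMatricesLieSubalgebra, mem_skewAdjointMatricesSubmodule,
    Matrix.IsSkewAdjoint, Matrix.IsAdjointPair, ← Matrix.ext_iff]
  have h1 : ∀ i j, (A.transpose * antidiagonal n) i j = A j.rev i := by
    intro i j
    simp [Matrix.mul_apply, antidiagonal]
  have h2 : ∀ i j, (antidiagonal n * -A) i j = -A i.rev j := by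
    intro i j
    have : ∀ x : Fin n, (i = x.rev) = (x = i.rev) := fun x =>
      propext ⟨fun h => by rw [h, Fin.rev_rev], fun h => by rw [h, Fin.rev_rev]⟩
    simp [Matrix.mul_apply, antidiagonal, this]
  simp only [h1, h2]
  constructor
  · intro h i j
    have := h j i.rev
    rwa [Fin.rev_rev] at this
  · intro h i j
    have := h j.rev i
    rwa [Fin.rev_rev] at this

/-- The elements `F_{ij} = E_{ij} - E_{j'i'}` of `𝔰𝔬_n`. -/
def F (n : ℕ) (i j : Fin n) : so n :=
  ⟨Matrix.single i j 1 - Matrix.single j.rev i.rev 1, by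
    rw [mem_so_iff]
    intro a b
    simp only [Matrix.sub_apply, Matrix.single_apply, neg_sub]
    congr 2 <;> grind [Fin.rev_rev]⟩

/-- The formal power series `det(I_n - q (F_{ij}))` in `q` with coefficients in `S(𝔰𝔬_n)`. -/
def detSeries (n : ℕ) : PowerSeries (SymmetricAlgebra ℂ (so n)) :=
  Matrix.det (1 - (PowerSeries.X : PowerSeries (SymmetricAlgebra ℂ (so n))) •
    (Matrix.of fun i j : Fin n => PowerSeries.C (SymmetricAlgebra.ι ℂ (so n) (F n i j))))

/-- `Φ_d ∈ S(𝔰𝔬_n)`: the coefficient of `q ^ d` in the formal power series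
`det(I_n - q (F_{ij}))⁻¹`. -/
def Phi (n d : ℕ) : SymmetricAlgebra ℂ (so n) :=
  PowerSeries.coeff d (PowerSeries.invOfUnit (detSeries n) 1)

theorem detSeries_mul_invOfUnit (n : ℕ) :
    detSeries n * PowerSeries.invOfUnit (detSeries n) 1 = 1 := by
  apply PowerSeries.mul_invOfUnit
  rw [detSeries, RingHom.map_det]
  have : (PowerSeries.constantCoeff (R := SymmetricAlgebra ℂ (so n))).mapMatrix
      (1 - (PowerSeries.X : PowerSeries (SymmetricAlgebra ℂ (so n))) •
        (Matrix.of fun i j : Fin n => PowerSeries.C (SymmetricAlgebra.ι ℂ (so n) (F n i j)))) =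
      1 := by
    ext i j
    by_cases h : i = j <;> simp [h, Matrix.one_apply]
  rw [this]
  simp

end Orthogonal

end SymmetrisationMap

end

/-! Contraction of a symmetrised tensor with `ad` is a polarisation. For `f` of degree `d`, the
first tensor factor of `ϖ(f)` runs over a Leibniz expansion of `f`. Let `∂_{ab}` be the derivation
of `S(𝔤)` extending the matrix entry `y ↦ y_{ab}`. Because `∑ y_{ab} F_{ab} = 2y`, absorbing one
tensor factor into `𝔤𝔩(𝔤)` is `1/(2d)` times the operator `x ⊗ f ↦ ∑ x ad(F_{ab}) ⊗ ∂_{ab} f`, up to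
symmetrisation (`absorb_tensorSymmetrisation`). Hence `8d(d-1)(d-2) 𝗆(Φ_d)` comes from the cube of
this operator on `1 ⊗ Φ_d`, and `2d` times the embedded `Φ_d` from its first power.

Left and right multiplication commute and agree on `1 ⊗ f`, so right multiplication by `ad(F_{ab})`
may be replaced by left multiplication. Evaluated at `y ∈ 𝔤`, the left operator becomes `W ↦ ∑
[F_{ab}, ∂_{ab} W]` on matrices over `S(𝔤)` (`adDiv`).

The cube is computed for all degrees at once. Let `N` be the transpose of `(F_{ij})`, `H = det(1 -
qN)⁻¹`, `G = (1 - qN)⁻¹`, and `K = (1 + qN)⁻¹`, the antidiagonal transpose of `G`. Then `∂_{ab} H =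
qH tr(F_{ba} G)` and `∂_{ab} G = q G F_{ba} G`, the sums over `a, b` collapse to traces and
antidiagonal transposes, and `2GK = G + K` reduces all words. With `θ = q d/dq` the outcome
(`adDiv_third_power`) is that the cube on `Hy` equals `4q²(θ + n)(θ + n - 1)` applied to the first
power. The coefficient of `q^{2k}` gives the factor `4(n+2k-2)(n+2k-3)`, and dividing by the degree
factors leaves `R(k) = binom(n+2k-2, 2)/(k(2k-1))`. -/

noncomputable section

namespace SymmetrisationMap

/-! ### Sums over the spanning set `F_{ab}`, and the operator `adDiv`. -/

section MatrixCalculus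

variable {R : Type*} {n : ℕ}

/-- The transpose of a matrix with respect to the antidiagonal. -/
def antiT (A : Matrix (Fin n) (Fin n) R) : Matrix (Fin n) (Fin n) R :=
  Matrix.of fun i j => A j.rev i.rev

theorem antiT_apply (A : Matrix (Fin n) (Fin n) R) (i j : Fin n) :
    antiT A i j = A j.rev i.rev := rfl

theorem antiT_antiT (A : Matrix (Fin n) (Fin n) R) : antiT (antiT A) = A := by
  ext i j; simp [antiT_apply]

variable [CommRing R]

theorem antiT_sub (A B : Matrix (Fin n) (Fin n) R) : antiT (A - B) = antiT A - antiT B := by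
  ext i j; simp [antiT_apply]

theorem antiT_smul (r : R) (A : Matrix (Fin n) (Fin n) R) : antiT (r • A) = r • antiT A := by
  ext i j; simp [antiT_apply]

theorem antiT_one : antiT (1 : Matrix (Fin n) (Fin n) R) = 1 := by
  ext i j; simp [antiT_apply, Matrix.one_apply, eq_comm]

theorem antiT_mul (A B : Matrix (Fin n) (Fin n) R) : antiT (A * B) = antiT B * antiT A := by
  ext i j
  simp only [antiT_apply, Matrix.mul_apply]
  exact Fintype.sum_equiv Fin.revPerm _ _ (fun x => by simp [mul_comm])

theorem trace_antiT (A : Matrix (Fin n) (Fin n) R) : (antiT A).trace = A.trace := by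
  simp only [Matrix.trace, Matrix.diag_apply, antiT_apply]
  exact Fintype.sum_equiv Fin.revPerm _ _ (fun x => by simp)

variable (R) in
/-- The matrix `E_{ab} - E_{b'a'}` over a commutative ring. -/
def skewUnit (a b : Fin n) : Matrix (Fin n) (Fin n) R :=
  Matrix.single a b 1 - Matrix.single b.rev a.rev 1

theorem antiT_skewUnit (a b : Fin n) : antiT (skewUnit R a b) = -skewUnit R a b := by
  ext i j
  simp only [antiT_apply, skewUnit, Matrix.sub_apply, Matrix.single_apply, Matrix.neg_apply, neg_sub]
  congr 2 <;> grind [Fin.rev_rev]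

/-- Reindexing of a double sum along `(a, b) ↦ (b', a')`. -/
theorem sum_sum_rev {M : Type*} [AddCommMonoid M] {n : ℕ} (f : Fin n → Fin n → M) :
    ∑ a : Fin n, ∑ b : Fin n, f b.rev a.rev = ∑ a, ∑ b, f a b := by
  rw [Finset.sum_comm]
  refine Fintype.sum_equiv Fin.revPerm _ _ fun a => ?_
  exact Fintype.sum_equiv Fin.revPerm _ _ fun b => rfl

/-- Expanding both skew units gives four sums, which agree in pairs under `(a, b) ↦ (b', a')`. One
pair yields the trace and the other the antidiagonal transpose. -/
theorem sum_skewUnit_mul_mul (A : Matrix (Fin n) (Fin n) R) :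
    ∑ a, ∑ b, skewUnit R a b * A * skewUnit R b a = (2 : R) • (A.trace • 1 - antiT A) := by
  have h1 : ∑ a : Fin n, ∑ b : Fin n,
      Matrix.single a b (1 : R) * A * Matrix.single b a (1 : R) = A.trace • 1 := by
    ext i j
    simp [Matrix.single_mul_mul_single, Matrix.sum_apply, Matrix.single_apply, Matrix.one_apply,
      Matrix.trace, ite_and]
  have h2 : ∑ a : Fin n, ∑ b : Fin n,
      Matrix.single a b (1 : R) * A * Matrix.single a.rev b.rev (1 : R) = antiT A := by
    ext i j
    have hj : ∀ b : Fin n, (b.rev = j) = (b = j.rev) := fun b =>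
      propext ⟨fun h => by rw [← h, Fin.rev_rev], fun h => by rw [h, Fin.rev_rev]⟩
    simp [Matrix.single_mul_mul_single, Matrix.sum_apply, Matrix.single_apply, antiT_apply, ite_and,
      hj]
  have h3 := sum_sum_rev fun a b : Fin n =>
    Matrix.single a b (1 : R) * A * Matrix.single b a (1 : R)
  have h4 := sum_sum_rev fun a b : Fin n =>
    Matrix.single a b (1 : R) * A * Matrix.single a.rev b.rev (1 : R)
  simp only [Fin.rev_rev] at h4
  simp only [skewUnit, sub_mul, mul_sub, Finset.sum_sub_distrib, h3, h4, h1, h2]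
  module

/-- The trace is the `(a, b)` entry of `Y - Y'`, so the sum expands this matrix in the `F_{ab}`; the
factor 2 appears because `Y - Y'` is already skew. -/
theorem sum_skewUnit_trace (Y : Matrix (Fin n) (Fin n) R) :
    ∑ a, ∑ b, (skewUnit R b a * Y).trace • skewUnit R a b = (2 : R) • (Y - antiT Y) := by
  have h1 : ∀ a b, (skewUnit R b a * Y).trace = (Y - antiT Y) a b := fun a b => by
    simp [skewUnit, sub_mul, Matrix.trace_single_mul, antiT_apply]
  have h2 : ∀ Z : Matrix (Fin n) (Fin n) R,
      ∑ a, ∑ b, Z a b • Matrix.single a b (1 : R) = Z := fun Z => by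
    ext i j
    simp [Matrix.sum_apply, Matrix.single_apply, ite_and]
  have h3 := sum_sum_rev fun a b : Fin n => (antiT (Y - antiT Y)) a b • Matrix.single a b (1 : R)
  simp only [antiT_apply (Y - antiT Y), Fin.rev_rev] at h3
  simp only [h1]
  simp only [skewUnit, smul_sub, Finset.sum_sub_distrib (f := fun _ => _), h2, h3]
  have h4 := h2 (antiT (Y - antiT Y))
  simp only [antiT_apply (Y - antiT Y)] at h4
  rw [h4, antiT_sub, antiT_antiT]
  module

/-- The bilinear expression `tr(A) B - A' B - tr(B) A + A B'`. -/
def traceForm (A B : Matrix (Fin n) (Fin n) R) : Matrix (Fin n) (Fin n) R :=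
  A.trace • B - antiT A * B - B.trace • A + A * antiT B

theorem sum_skewUnit_commutator (A B : Matrix (Fin n) (Fin n) R) :
    ∑ a, ∑ b, (skewUnit R a b * (A * skewUnit R b a * B) - A * skewUnit R b a * B * skewUnit R a b) =
      (2 : R) • traceForm A B := by
  have h1 : ∑ a, ∑ b, skewUnit R a b * (A * skewUnit R b a * B) =
      (2 : R) • ((A.trace • 1 - antiT A) * B) := by
    rw [← smul_mul_assoc, ← sum_skewUnit_mul_mul]
    simp only [Finset.sum_mul, mul_assoc]
  have h2 : ∑ a, ∑ b, A * skewUnit R b a * B * skewUnit R a b =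
      (2 : R) • (A * (B.trace • 1 - antiT B)) := by
    rw [← mul_smul_comm, ← sum_skewUnit_mul_mul, Finset.sum_comm]
    simp only [Finset.mul_sum, mul_assoc]
  simp only [Finset.sum_sub_distrib, h1, h2, traceForm, sub_mul, mul_sub, smul_mul_assoc, one_mul,
    mul_smul_comm, mul_one]
  module

variable [Algebra ℂ R]

/-- A derivation applied to the entries of a product of matrices. -/
theorem map_derivation_mul (d : Derivation ℂ R R) (A B : Matrix (Fin n) (Fin n) R) :
    (A * B).map d = A.map d * B + A * B.map d := by
  ext i j
  simp only [Matrix.map_apply, Matrix.mul_apply, map_sum, Derivation.leibniz, smul_eq_mul,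
    Matrix.add_apply, ← Finset.sum_add_distrib]
  exact Finset.sum_congr rfl fun x _ => by ring

theorem map_derivation_smul (d : Derivation ℂ R R) (r : R) (A : Matrix (Fin n) (Fin n) R) :
    (r • A).map d = d r • A + r • A.map d := by
  ext i j
  simp only [Matrix.map_apply, Matrix.smul_apply, Derivation.leibniz, smul_eq_mul, Matrix.add_apply]
  ring

theorem map_derivation_add (d : Derivation ℂ R R) (A B : Matrix (Fin n) (Fin n) R) :
    (A + B).map d = A.map d + B.map d := by
  ext i j; simp

theorem map_derivation_sub (d : Derivation ℂ R R) (A B : Matrix (Fin n) (Fin n) R) :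
    (A - B).map d = A.map d - B.map d := by
  ext i j; simp

theorem map_derivation_antiT (d : Derivation ℂ R R) (A : Matrix (Fin n) (Fin n) R) :
    (antiT A).map d = antiT (A.map d) := rfl

theorem trace_map_derivation (d : Derivation ℂ R R) (A : Matrix (Fin n) (Fin n) R) :
    (A.map d).trace = d A.trace := by
  simp [Matrix.trace]

/-- The operator `W ↦ ∑_{a,b} [F_{ab}, ∂_{ab} W]` on matrices, for a family of derivations
`∂_{ab}`. -/
def adDiv (D : Fin n → Fin n → Derivation ℂ R R) (W : Matrix (Fin n) (Fin n) R) :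
    Matrix (Fin n) (Fin n) R :=
  ∑ a, ∑ b, (skewUnit R a b * W.map (D a b) - W.map (D a b) * skewUnit R a b)

variable (D : Fin n → Fin n → Derivation ℂ R R)

theorem adDiv_add (V W : Matrix (Fin n) (Fin n) R) :
    adDiv D (V + W) = adDiv D V + adDiv D W := by
  simp only [adDiv, map_derivation_add, mul_add, add_mul, ← Finset.sum_add_distrib]
  exact Finset.sum_congr rfl fun a _ => Finset.sum_congr rfl fun b _ => by abel

theorem adDiv_sub (V W : Matrix (Fin n) (Fin n) R) :
    adDiv D (V - W) = adDiv D V - adDiv D W := by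
  simp only [adDiv, map_derivation_sub, mul_sub, sub_mul, ← Finset.sum_sub_distrib]
  exact Finset.sum_congr rfl fun a _ => Finset.sum_congr rfl fun b _ => by abel

/-- By the Leibniz rule the extra term is the commutator of `W` with `∑ (∂_{ab} r) F_{ab}`, which
`sum_skewUnit_trace` evaluates. -/
theorem adDiv_smul {r s : R} {Y : Matrix (Fin n) (Fin n) R}
    (hr : ∀ a b, D a b r = s * (skewUnit R b a * Y).trace) (W : Matrix (Fin n) (Fin n) R) :
    adDiv D (r • W) =
      r • adDiv D W + (2 * s) • ((Y - antiT Y) * W - W * (Y - antiT Y)) := by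
  have h : ∑ a, ∑ b, (D a b r • (skewUnit R a b * W) - D a b r • (W * skewUnit R a b)) =
      (2 * s) • ((Y - antiT Y) * W - W * (Y - antiT Y)) := by
    have h1 : ∑ a, ∑ b, D a b r • skewUnit R a b = (2 * s) • (Y - antiT Y) := by
      simp only [hr, mul_smul, ← Finset.smul_sum, sum_skewUnit_trace]
      module
    have h2 : ∑ a, ∑ b, D a b r • (skewUnit R a b * W) =
        (∑ a, ∑ b, D a b r • skewUnit R a b) * W := by
      simp only [Finset.sum_mul, smul_mul_assoc]
    have h3 : ∑ a, ∑ b, D a b r • (W * skewUnit R a b) =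
        W * (∑ a, ∑ b, D a b r • skewUnit R a b) := by
      simp only [Finset.mul_sum, mul_smul_comm]
    simp only [Finset.sum_sub_distrib, h2, h3, h1]
    rw [smul_mul_assoc, mul_smul_comm, smul_sub]
  rw [← h]
  simp only [adDiv, Finset.smul_sum, ← Finset.sum_add_distrib, map_derivation_smul]
  refine Finset.sum_congr rfl fun a _ => Finset.sum_congr rfl fun b _ => ?_
  simp only [mul_add, add_mul, smul_mul_assoc, mul_smul_comm]
  module

theorem adDiv_smul_of_const {r : R} (hr : ∀ a b, D a b r = 0) (W : Matrix (Fin n) (Fin n) R) :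
    adDiv D (r • W) = r • adDiv D W := by
  rw [adDiv_smul D (s := 0) (Y := 0) (by simpa using hr)]
  simp

theorem adDiv_of_map_eq {q : R} {W A B : Matrix (Fin n) (Fin n) R}
    (h : ∀ a b, W.map (D a b) = q • (A * skewUnit R b a * B)) :
    adDiv D W = (2 * q) • traceForm A B := by
  have := sum_skewUnit_commutator A B
  simp only [adDiv, h, mul_smul_comm, smul_mul_assoc, ← smul_sub, ← Finset.smul_sum, this]
  module

theorem adDiv_of_map_eq_add {q : R} {W A B A' B' : Matrix (Fin n) (Fin n) R}
    (h : ∀ a b, W.map (D a b) = q • (A * skewUnit R b a * B + A' * skewUnit R b a * B')) :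
    adDiv D W = (2 * q) • (traceForm A B + traceForm A' B') := by
  have h1 := sum_skewUnit_commutator A B
  have h2 := sum_skewUnit_commutator A' B'
  have h3 : adDiv D W = q • (∑ a, ∑ b, (skewUnit R a b * (A * skewUnit R b a * B) -
      A * skewUnit R b a * B * skewUnit R a b) + ∑ a, ∑ b, (skewUnit R a b *
      (A' * skewUnit R b a * B') - A' * skewUnit R b a * B' * skewUnit R a b)) := by
    simp only [adDiv, h, Finset.smul_sum, ← Finset.sum_add_distrib]
    refine Finset.sum_congr rfl fun a _ => Finset.sum_congr rfl fun b _ => ?_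
    simp only [mul_smul_comm, smul_mul_assoc, mul_add, add_mul]
    module
  rw [h3, h1, h2]
  module

/-! ### `adDiv` on the words in the resolvent `G` and a constant matrix `w`. -/

section Words

variable {D} {q : R} {G w : Matrix (Fin n) (Fin n) R}
  (hG : ∀ a b, G.map (D a b) = q • (G * skewUnit R b a * G)) (hw : ∀ a b, w.map (D a b) = 0)

include hG

/-- Differentiating a word replaces one letter `G` at a time by `q G F_{ba} G`, so each occurrence
contributes one `traceForm` of what stands to its left and right, the new `G`s included. The words
treated here are those occurring in `secondTerm`. -/
theorem adDiv_resolvent : adDiv D G = (2 * q) • traceForm G G :=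
  adDiv_of_map_eq D hG

theorem derivation_trace_resolvent (a b : Fin n) :
    D a b G.trace = q * (skewUnit R b a * (G * G)).trace := by
  rw [← trace_map_derivation, hG, Matrix.trace_smul, smul_eq_mul, mul_assoc G, Matrix.trace_mul_comm,
    mul_assoc]

include hw

theorem derivation_trace_resolvent_mul (a b : Fin n) :
    D a b (G * w).trace = q * (skewUnit R b a * (G * w * G)).trace := by
  rw [← trace_map_derivation, map_derivation_mul, hG, hw, mul_zero, add_zero, smul_mul_assoc,
    Matrix.trace_smul, smul_eq_mul, mul_assoc G, mul_assoc G, Matrix.trace_mul_comm]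
  simp only [mul_assoc]

theorem adDiv_resolvent_mul : adDiv D (G * w) = (2 * q) • traceForm G (G * w) :=
  adDiv_of_map_eq D fun a b => by
    simp only [map_derivation_mul, hG, hw, mul_zero, add_zero, smul_mul_assoc, mul_assoc]

theorem adDiv_mul_resolvent : adDiv D (w * G) = (2 * q) • traceForm (w * G) G :=
  adDiv_of_map_eq D fun a b => by
    simp only [map_derivation_mul, hG, hw, zero_mul, zero_add, mul_smul_comm, mul_assoc]

theorem adDiv_resolvent_sq_mul :
    adDiv D (G * G * w) = (2 * q) • (traceForm G (G * G * w) + traceForm (G * G) (G * w)) :=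
  adDiv_of_map_eq_add D fun a b => by
    simp only [map_derivation_mul, hG, hw, mul_zero, add_zero, smul_mul_assoc, mul_smul_comm,
      mul_assoc, smul_add]

theorem adDiv_mul_resolvent_sq :
    adDiv D (w * (G * G)) = (2 * q) • (traceForm (w * G) (G * G) + traceForm (w * G * G) G) :=
  adDiv_of_map_eq_add D fun a b => by
    simp only [map_derivation_mul, hG, hw, zero_mul, zero_add, smul_mul_assoc, mul_smul_comm,
      mul_add, mul_assoc, smul_add]

theorem adDiv_resolvent_mul_resolvent :
    adDiv D (G * w * G) = (2 * q) • (traceForm G (G * w * G) + traceForm (G * w * G) G) :=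
  adDiv_of_map_eq_add D fun a b => by
    simp only [map_derivation_mul, hG, hw, zero_mul, zero_add, smul_mul_assoc,
      mul_smul_comm, mul_assoc, smul_add]

end Words

end MatrixCalculus

/-! ### The cube of `adDiv` on `H w`. -/

section ThirdPower

variable {R : Type*} [CommRing R] [Algebra ℂ R] {n : ℕ}
  {D : Fin n → Fin n → Derivation ℂ R R} {q H : R} {G K w : Matrix (Fin n) (Fin n) R}

theorem adDiv_smul_const (hH : ∀ a b, D a b H = q * H * (skewUnit R b a * G).trace)
    (hw : ∀ a b, w.map (D a b) = 0) (hGK : antiT G = K) :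
    adDiv D (H • w) = (2 * (q * H)) • ((G - K) * w - w * (G - K)) := by
  have h0 : adDiv D w = 0 := by simp [adDiv, hw]
  rw [adDiv_smul D hH, hGK, h0, smul_zero, zero_add]

/-- `K` obeys the law of `G` with `-q` for `q`, since skew units change sign under the transpose.
The formulas for words in `G` thus apply to `K` as well. -/
theorem map_antiT_resolvent (hG : ∀ a b, G.map (D a b) = q • (G * skewUnit R b a * G))
    (hGK : antiT G = K) (a b : Fin n) :
    K.map (D a b) = (-q) • (K * skewUnit R b a * K) := by
  rw [← hGK, map_derivation_antiT, hG, antiT_smul, antiT_mul, antiT_mul, antiT_skewUnit]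
  simp [mul_assoc]

/-- Up to the factor `4 q² H`, the value of the square of `adDiv` on `H w`. -/
def secondTerm (G K w : Matrix (Fin n) (Fin n) R) : Matrix (Fin n) (Fin n) R :=
  G * G * w + K * K * w + w * (G * G) + w * (K * K) +
    (G.trace - 2) • (G * w + K * w + w * G + w * K) -
      (2 : R) • (G * w * G + K * w * K) - (2 * (G * w).trace) • (G - K)

variable (hG : ∀ a b, G.map (D a b) = q • (G * skewUnit R b a * G))
  (hH : ∀ a b, D a b H = q * H * (skewUnit R b a * G).trace) (hq : ∀ a b, D a b q = 0)
  (hw : ∀ a b, w.map (D a b) = 0) (hwT : antiT w = -w) (hGK : antiT G = K)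
  (hE : (2 : R) • (G * K) = G + K) (hcomm : K * G = G * K)

include hG hH hq hw hwT hGK hE hcomm

theorem adDiv_adDiv_smul_const :
    adDiv D (adDiv D (H • w)) = (4 * (q * q * H)) • secondTerm G K w := by
  have hKG : antiT K = G := by rw [← hGK, antiT_antiT]
  have hK := map_antiT_resolvent hG hGK
  have hr : ∀ a b, D a b (2 * (q * H)) = 2 * (q * q * H) * (skewUnit R b a * G).trace := by
    intro a b
    have h2 : D a b (2 : R) = 0 := by exact_mod_cast (D a b).map_natCast 2
    simp only [Derivation.leibniz, hH, hq, h2, smul_eq_mul]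
    ring
  have hKt : K.trace = G.trace := by rw [← hGK, trace_antiT]
  have h1 : (w * G).trace = (G * w).trace := Matrix.trace_mul_comm _ _
  have h2 : (K * w).trace = -(G * w).trace := by
    rw [← trace_antiT, antiT_mul, hwT, hKG, neg_mul, Matrix.trace_neg, h1]
  have h3 : (w * K).trace = -(G * w).trace := by rw [Matrix.trace_mul_comm, h2]
  rw [adDiv_smul_const hH hw hGK, adDiv_smul D hr, hGK]
  simp only [mul_sub, sub_mul, adDiv_sub, adDiv_resolvent_mul hG hw, adDiv_resolvent_mul hK hw,
    adDiv_mul_resolvent hG hw, adDiv_mul_resolvent hK hw, traceForm, antiT_mul, hwT, hGK, hKG,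
    h1, h2, h3, hKt, secondTerm]
  -- Normal form: put `E = GK`, so `K = 2E - G`. Then `E` commutes with `G`, and `E = G(2E - G)`
  -- gives `G² = 2GE - E`. Every power of `G` and `K` becomes a combination of `E^j` and `G E^j`,
  -- and the identity becomes linear in the remaining words.
  obtain ⟨E, hE'⟩ : ∃ E, E = G * K := ⟨_, rfl⟩
  have hKE : K = (2 : R) • E - G := by rw [hE', hE]; abel
  have hEG : E * G = G * E := by rw [hE', mul_assoc, hcomm]
  have hGG : G * G = (2 : R) • (G * E) - E := by
    have : E = G * ((2 : R) • E - G) := by rw [← hKE, ← hE']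
    rw [mul_sub, mul_smul_comm] at this
    rw [eq_sub_iff_add_eq, add_comm, ← eq_sub_iff_add_eq]; exact this
  have hEG' : ∀ X, E * (G * X) = G * (E * X) := fun X => by
    rw [← mul_assoc, hEG, mul_assoc]
  have hGG' : ∀ X, G * (G * X) = (2 : R) • (G * (E * X)) - E * X := fun X => by
    rw [← mul_assoc, hGG, sub_mul, smul_mul_assoc, mul_assoc]
  simp only [hKE, mul_assoc, mul_sub, sub_mul, mul_neg, neg_mul, mul_smul_comm,
    smul_mul_assoc, hEG, hEG', hGG, hGG', smul_add, smul_sub]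
  module

/-- The value of the third power of `adDiv` on `H w`. -/
theorem adDiv_adDiv_adDiv_smul_const :
    adDiv D (adDiv D (adDiv D (H • w))) = (8 * (q * q * q * H)) •
      ((2 : R) • ((G * G * G - K * K * K) * w - w * (G * G * G - K * K * K)) +
        (2 * G.trace - 2) • ((G * G - K * K) * w - w * (G * G - K * K)) +
        (G.trace * G.trace + (G * G).trace - 2 * G.trace) • ((G - K) * w - w * (G - K))) := by
  have hKG : antiT K = G := by rw [← hGK, antiT_antiT]
  have hK := map_antiT_resolvent hG hGK
  have hc : ∀ a b, D a b (2 : R) = 0 := fun a b => by exact_mod_cast (D a b).map_natCast 2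
  have hr : ∀ a b, D a b (4 * (q * q * H)) = 4 * (q * q * q * H) * (skewUnit R b a * G).trace := by
    intro a b
    have h4 : D a b (4 : R) = 0 := by exact_mod_cast (D a b).map_natCast 4
    simp only [Derivation.leibniz, hH, hq, h4, smul_eq_mul]
    ring
  have ht : ∀ a b, D a b (G.trace - 2) = q * (skewUnit R b a * (G * G)).trace := fun a b => by
    rw [map_sub, hc, sub_zero, derivation_trace_resolvent hG]
  have hτ : ∀ a b, D a b (2 * (G * w).trace) = 2 * q * (skewUnit R b a * (G * w * G)).trace :=
    fun a b => by
      rw [Derivation.leibniz, hc, smul_zero, add_zero, derivation_trace_resolvent_mul hG hw,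
        smul_eq_mul, ← mul_assoc]
  have hKt : K.trace = G.trace := by rw [← hGK, trace_antiT]
  have hKKt : (K * K).trace = (G * G).trace := by rw [← hGK, ← antiT_mul, trace_antiT]
  have h1 : (w * G).trace = (G * w).trace := Matrix.trace_mul_comm _ _
  have h2 : (K * w).trace = -(G * w).trace := by
    rw [← trace_antiT, antiT_mul, hwT, hKG, neg_mul, Matrix.trace_neg, h1]
  have h3 : (w * K).trace = -(G * w).trace := by rw [Matrix.trace_mul_comm, h2]
  have h4 : (w * G * G).trace = (G * G * w).trace := by rw [mul_assoc, Matrix.trace_mul_comm]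
  have h5 : (w * K * K).trace = (K * K * w).trace := by rw [mul_assoc, Matrix.trace_mul_comm]
  -- The two trace terms of `traceForm G G` cancel, and so do `KG` and `GK`. Therefore only the
  -- scalar factor of `tr(Gw)(G - K)` is differentiated below.
  have h6 : adDiv D G = 0 := by
    rw [adDiv_resolvent hG]
    simp [traceForm, hGK, hcomm]
  have h6' : adDiv D K = 0 := by
    rw [adDiv_resolvent hK]
    simp [traceForm, hKG, hcomm]
  rw [adDiv_adDiv_smul_const hG hH hq hw hwT hGK hE hcomm, adDiv_smul D hr, hGK]
  have h7 : adDiv D (secondTerm G K w) = (2 * q) •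
      (traceForm G (G * G * w) + traceForm (G * G) (G * w) -
        (traceForm K (K * K * w) + traceForm (K * K) (K * w)) +
        (traceForm (w * G) (G * G) + traceForm (w * G * G) G) -
        (traceForm (w * K) (K * K) + traceForm (w * K * K) K) +
        (G.trace - 2) • (traceForm G (G * w) - traceForm K (K * w) + traceForm (w * G) G -
          traceForm (w * K) K) +
        ((G * G - K * K) * (G * w + K * w + w * G + w * K) -
          (G * w + K * w + w * G + w * K) * (G * G - K * K)) -
        (2 : R) • (traceForm G (G * w * G) + traceForm (G * w * G) G -
          (traceForm K (K * w * K) + traceForm (K * w * K) K)) -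
        (2 : R) • ((G * w * G + K * w * K) * (G - K) - (G - K) * (G * w * G + K * w * K))) := by
    -- This is the transpose needed when `tr(Gw)` is differentiated. Its sign, from the skewness of
    -- `w`, makes the resulting commutator involve `GwG + KwK`.
    have h8 : antiT (G * w * G) = -(K * w * K) := by
      simp only [antiT_mul, hGK, hwT, mul_neg, neg_mul, mul_assoc]
    have h9 : antiT (G * G) = K * K := by rw [antiT_mul, hGK]
    simp only [secondTerm, adDiv_sub, adDiv_add, adDiv_resolvent_sq_mul hG hw,
      adDiv_resolvent_sq_mul hK hw, adDiv_mul_resolvent_sq hG hw, adDiv_mul_resolvent_sq hK hw,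
      adDiv_smul D ht, adDiv_smul_of_const D hc, adDiv_smul D hτ, adDiv_resolvent_mul_resolvent hG hw,
      adDiv_resolvent_mul_resolvent hK hw, adDiv_resolvent_mul hG hw, adDiv_resolvent_mul hK hw,
      adDiv_mul_resolvent hG hw, adDiv_mul_resolvent hK hw, h6, h6', h8, h9, sub_neg_eq_add]
    module
  rw [h7, secondTerm]
  simp only [traceForm, antiT_mul, hwT, hGK, hKG, h1, h2, h3, h4, h5, hKt, hKKt]
  -- The same normal form in `G` and `E = GK` as for the square.
  obtain ⟨E, hE'⟩ : ∃ E, E = G * K := ⟨_, rfl⟩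
  have hKE : K = (2 : R) • E - G := by rw [hE', hE]; abel
  have hEG : E * G = G * E := by rw [hE', mul_assoc, hcomm]
  have hGG : G * G = (2 : R) • (G * E) - E := by
    have : E = G * ((2 : R) • E - G) := by rw [← hKE, ← hE']
    rw [mul_sub, mul_smul_comm] at this
    rw [eq_sub_iff_add_eq, add_comm, ← eq_sub_iff_add_eq]; exact this
  have hEG' : ∀ X, E * (G * X) = G * (E * X) := fun X => by
    rw [← mul_assoc, hEG, mul_assoc]
  have hGG' : ∀ X, G * (G * X) = (2 : R) • (G * (E * X)) - E * X := fun X => by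
    rw [← mul_assoc, hGG, sub_mul, smul_mul_assoc, mul_assoc]
  simp only [hKE, mul_assoc, mul_add, add_mul, mul_sub, sub_mul, mul_neg, neg_mul, mul_smul_comm,
    smul_mul_assoc, hEG, hEG', hGG, hGG', smul_add, smul_sub]
  module

/-- The third power of `adDiv` on `H w`, through a derivation `θ` which multiplies a homogeneous
expression in `q` by its degree. -/
theorem adDiv_third_power (θ : Derivation ℂ R R) (hθq : θ q = q)
    (hθH : θ H = (G.trace - n) * H) (hθG : G.map θ = G * G - G) (hθw : w.map θ = 0) :
    adDiv D (adDiv D (adDiv D (H • w))) =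
      (4 * (q * q)) • (((adDiv D (H • w)).map θ).map θ +
        (2 * n - 1 : R) • (adDiv D (H • w)).map θ + (n * (n - 1) : R) • adDiv D (H • w)) := by
  rw [adDiv_adDiv_adDiv_smul_const hG hH hq hw hwT hGK hE hcomm, adDiv_smul_const hH hw hGK]
  have hθK : K.map θ = K * K - K := by
    rw [← hGK, map_derivation_antiT, hθG, antiT_sub, antiT_mul]
  have hθ2 : θ (2 : R) = 0 := by exact_mod_cast θ.map_natCast 2
  have hθ1 : θ (1 : R) = 0 := θ.map_one_eq_zero
  have hθn : θ (n : R) = 0 := θ.map_natCast n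
  have hθt : θ G.trace = (G * G).trace - G.trace := by
    rw [← trace_map_derivation, hθG, Matrix.trace_sub]
  have e1 : ∀ r : R, θ (2 * (q * H) * r) =
      2 * (q * H) * ((G.trace - n + 1) * r + θ r) := fun r => by
    simp only [Derivation.leibniz, hθ2, hθq, hθH, smul_eq_mul]
    ring
  have e2 : (((G - K) * w - w * (G - K)).map θ) =
      (G * G - K * K) * w - w * (G * G - K * K) - ((G - K) * w - w * (G - K)) := by
    simp only [map_derivation_sub, map_derivation_mul, hθG, hθK, hθw, mul_sub, sub_mul, mul_zero,
      zero_mul]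
    abel
  have e3 : (((G * G - K * K) * w - w * (G * G - K * K)).map θ) =
      (2 : R) • ((G * G * G - K * K * K) * w - w * (G * G * G - K * K * K)) -
        (2 : R) • ((G * G - K * K) * w - w * (G * G - K * K)) := by
    simp only [map_derivation_sub, map_derivation_mul, hθG, hθK, hθw, mul_sub, sub_mul, mul_zero,
      zero_mul, mul_add, mul_assoc]
    module
  have e4 : ∀ (r : R) (P : Matrix (Fin n) (Fin n) R), ((2 * (q * H) * r) • P).map θ =
      (2 * (q * H)) • (((G.trace - n + 1) * r + θ r) • P + r • P.map θ) := fun r P => by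
    rw [map_derivation_smul, e1]
    module
  -- Both sides are combinations of the commutators of `G^i - K^i` with `w`, on which `θP₁ = P₂ -
  -- P₁` and `θP₂ = 2P₃ - 2P₂`. It remains to compare scalar coefficients.
  generalize hP1 : (G - K) * w - w * (G - K) = P1 at *
  generalize hP2 : (G * G - K * K) * w - w * (G * G - K * K) = P2 at *
  generalize hP3 : (G * G * G - K * K * K) * w - w * (G * G * G - K * K * K) = P3 at *
  have e5 : ((2 * (q * H)) • P1).map θ =
      (2 * (q * H) * (G.trace - n)) • P1 + (2 * (q * H) * 1) • P2 := by
    have := e4 1 P1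
    rw [mul_one] at this
    rw [this, e2, hθ1]
    module
  rw [e5, map_derivation_add, e4, e4, e2, e3]
  simp only [map_sub, hθt, hθn, hθ1]
  module

end ThirdPower

/-! ### Algebraic relations between `G` and its antidiagonal transpose. -/

section Resolvent

variable {R : Type*} [CommRing R] {n : ℕ} {q : R} {N G : Matrix (Fin n) (Fin n) R}

theorem resolvent_mul_smul (hG : G * (1 - q • N) = 1) : G * (q • N) = G - 1 := by
  rw [mul_sub, mul_one] at hG
  rw [← hG]; abel

variable (hNT : antiT N = -N) (hG : G * (1 - q • N) = 1)

include hNT hG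

theorem antiT_resolvent_mul : antiT G * (1 + q • N) = 1 := by
  have h := congrArg antiT hG
  rw [antiT_mul, antiT_sub, antiT_smul, hNT, antiT_one, smul_neg, sub_neg_eq_add] at h
  exact mul_eq_one_comm.1 h

/-- Partial fractions: `G + K = G((1 + qN) + (1 - qN))K`. -/
theorem two_smul_resolvent_mul_antiT : (2 : R) • (G * antiT G) = G + antiT G := by
  have hK : (1 + q • N) * antiT G = 1 :=
    mul_eq_one_comm.1 (antiT_resolvent_mul hNT hG)
  have h1 : G + antiT G = G * ((1 + q • N) * antiT G) + G * (1 - q • N) * antiT G := by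
    rw [hK, hG, mul_one, one_mul]
  rw [h1]
  simp only [mul_add, add_mul, mul_sub, sub_mul, mul_one, one_mul, mul_assoc]
  module

theorem antiT_resolvent_comm : antiT G * G = G * antiT G := by
  have hK := antiT_resolvent_mul hNT hG
  have hK' := mul_eq_one_comm.1 hK
  have hG' := mul_eq_one_comm.1 hG
  have hAB : (1 + q • N) * (1 - q • N) = (1 - q • N) * (1 + q • N) := by
    simp only [mul_add, add_mul, mul_sub, sub_mul, mul_one, one_mul]
    abel
  -- Inverses of commuting matrices commute: insert `(1 + qN)(1 - qN)GK = 1` and exchange its first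
  -- two factors.
  calc antiT G * G = antiT G * G * ((1 + q • N) * (1 - q • N) * (G * antiT G)) := by
        rw [mul_assoc (1 + q • N), ← mul_assoc (1 - q • N), hG', one_mul, hK', mul_one]
    _ = antiT G * (G * (1 - q • N)) * ((1 + q • N) * (G * antiT G)) := by
        rw [hAB]; simp only [mul_assoc]
    _ = G * antiT G := by rw [hG, mul_one, ← mul_assoc, hK, one_mul]

end Resolvent

/-! ### Derivatives of determinants and inverse matrices. -/

section DerivationResolvent

variable {R : Type*} [CommRing R] [Algebra ℂ R]

theorem derivation_prod {ι : Type*} [DecidableEq ι] (d : Derivation ℂ R R) (s : Finset ι)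
    (f : ι → R) : d (∏ i ∈ s, f i) = ∑ i ∈ s, d (f i) * ∏ j ∈ s.erase i, f j := by
  induction s using Finset.induction_on with
  | empty => simp
  | insert a s ha ih =>
    rw [Finset.prod_insert ha, Derivation.leibniz, ih, Finset.sum_insert ha,
      Finset.erase_insert ha, smul_eq_mul, smul_eq_mul, Finset.mul_sum, add_comm, mul_comm]
    congr 1
    refine Finset.sum_congr rfl fun i hi => ?_
    have hia : i ≠ a := fun h => ha (h ▸ hi)
    rw [Finset.erase_insert_of_ne hia.symm, Finset.prod_insert (by simp [ha])]
    ring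

/-- Jacobi's formula for the derivative of a determinant. -/
theorem derivation_det {n : ℕ} (d : Derivation ℂ R R) (A : Matrix (Fin n) (Fin n) R) :
    d A.det = (A.adjugate * A.map d).trace := by
  have h1 : ∀ i, (A.adjugate * A.map d) i i = (A.updateCol i fun j => d (A j i)).det := by
    intro i
    rw [← Matrix.cramer_apply, Matrix.cramer_eq_adjugate_mulVec]
    rfl
  simp only [Matrix.trace, Matrix.diag_apply, h1, Matrix.det_apply, map_sum]
  rw [Finset.sum_comm]
  refine Finset.sum_congr rfl fun σ _ => ?_
  rw [← Finset.smul_sum]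
  have h2 : ∀ (u : ℤˣ) (x : R), d (u • x) = u • d x := fun u x => by
    rw [Units.smul_def, Units.smul_def, map_zsmul]
  rw [h2, derivation_prod]
  congr 1
  refine Finset.sum_congr rfl fun i hi => ?_
  rw [← Finset.mul_prod_erase _ _ hi]
  congr 1
  · simp
  · exact Finset.prod_congr rfl fun j hj => by
      rw [Matrix.updateCol_ne (Finset.ne_of_mem_erase hj)]

variable {n : ℕ} {q H : R} {N G : Matrix (Fin n) (Fin n) R}

/-- Differentiate `det A · H = 1` by Jacobi's formula, where the adjugate is `det A · G`;
multiplying by `H` cancels the determinant. -/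
theorem derivation_inv_det {A : Matrix (Fin n) (Fin n) R} (hH : A.det * H = 1) (hG : G * A = 1)
    (d : Derivation ℂ R R) : d H = -(G * A.map d).trace * H := by
  have hadj : A.adjugate = A.det • G := by
    have : G * (A * A.adjugate) = A.adjugate := by rw [← mul_assoc, hG, one_mul]
    rw [← this, Matrix.mul_adjugate, mul_smul_comm, mul_one]
  have h1 : d (A.det * H) = 0 := by rw [hH, Derivation.map_one_eq_zero]
  rw [Derivation.leibniz, derivation_det, hadj, smul_mul_assoc, Matrix.trace_smul] at h1
  simp only [smul_eq_mul] at h1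
  linear_combination H * h1 - (d H + (G * A.map d).trace * H) * hH

theorem map_derivation_inv {A : Matrix (Fin n) (Fin n) R} (hG : G * A = 1)
    (d : Derivation ℂ R R) : G.map d = -(G * A.map d * G) := by
  have h1 : (G * A).map d = 0 := by
    rw [hG]
    ext i j
    by_cases h : i = j <;> simp [h]
  rw [map_derivation_mul] at h1
  have h2 : A * G = 1 := mul_eq_one_comm.1 hG
  have h3 := congrArg (· * G) h1
  simp only [add_mul, mul_assoc, h2, mul_one, zero_mul] at h3
  rw [mul_assoc]
  exact eq_neg_of_add_eq_zero_left h3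

theorem map_one_sub_smul_of_const (d : Derivation ℂ R R) (hq : d q = 0) :
    (1 - q • N).map d = -(q • N.map d) := by
  rw [map_derivation_sub, map_derivation_smul, hq, zero_smul, zero_add]
  have : (1 : Matrix (Fin n) (Fin n) R).map d = 0 := by
    ext i j
    by_cases h : i = j <;> simp [h]
  rw [this, zero_sub]

theorem map_one_sub_smul_of_degree (d : Derivation ℂ R R) (hq : d q = q) (hN : N.map d = 0) :
    (1 - q • N).map d = -(q • N) := by
  rw [map_derivation_sub, map_derivation_smul, hq, hN, smul_zero, add_zero]
  have : (1 : Matrix (Fin n) (Fin n) R).map d = 0 := by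
    ext i j
    by_cases h : i = j <;> simp [h]
  rw [this, zero_sub]

end DerivationResolvent

/-! ### Derivations of the symmetric algebra. -/

section SymmetricDerivation

variable (L : Type*) [AddCommGroup L] [Module ℂ L]

/-- The algebra homomorphism `s ↦ s + ε ∂s` for the derivation `∂` extending a linear map. -/
def symDerivationHom (φ : L →ₗ[ℂ] SymmetricAlgebra ℂ L) :
    SymmetricAlgebra ℂ L →ₐ[ℂ] TrivSqZeroExt (SymmetricAlgebra ℂ L) (SymmetricAlgebra ℂ L) :=
  SymmetricAlgebra.lift
    ((TrivSqZeroExt.inlAlgHom ℂ (SymmetricAlgebra ℂ L) (SymmetricAlgebra ℂ L)).toLinearMap ∘ₗ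
      SymmetricAlgebra.ι ℂ L + (TrivSqZeroExt.inrHom (SymmetricAlgebra ℂ L)
        (SymmetricAlgebra ℂ L)).restrictScalars ℂ ∘ₗ φ)

variable {L}

theorem symDerivationHom_ι (φ : L →ₗ[ℂ] SymmetricAlgebra ℂ L) (y : L) :
    symDerivationHom L φ (SymmetricAlgebra.ι ℂ L y) =
      TrivSqZeroExt.inl (SymmetricAlgebra.ι ℂ L y) + TrivSqZeroExt.inr (φ y) := by
  rw [symDerivationHom, SymmetricAlgebra.lift_ι_apply]
  rfl

theorem fst_symDerivationHom (φ : L →ₗ[ℂ] SymmetricAlgebra ℂ L) (f : SymmetricAlgebra ℂ L) :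
    (symDerivationHom L φ f).fst = f := by
  have : (TrivSqZeroExt.fstHom ℂ (SymmetricAlgebra ℂ L) (SymmetricAlgebra ℂ L)).comp
      (symDerivationHom L φ) = AlgHom.id ℂ _ := by
    apply SymmetricAlgebra.algHom_ext
    ext y
    simp [symDerivationHom_ι]
  exact DFunLike.congr_fun this f

/-- The derivation of the symmetric algebra that extends a given linear map. -/
def symDerivation (φ : L →ₗ[ℂ] SymmetricAlgebra ℂ L) :
    Derivation ℂ (SymmetricAlgebra ℂ L) (SymmetricAlgebra ℂ L) :=
  Derivation.mk' ((TrivSqZeroExt.sndHom (SymmetricAlgebra ℂ L)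
    (SymmetricAlgebra ℂ L)).restrictScalars ℂ ∘ₗ (symDerivationHom L φ).toLinearMap) fun a b => by
      simp [fst_symDerivationHom, mul_comm b]

theorem symDerivation_ι (φ : L →ₗ[ℂ] SymmetricAlgebra ℂ L) (y : L) :
    symDerivation φ (SymmetricAlgebra.ι ℂ L y) = φ y := by
  simp [symDerivation, symDerivationHom_ι]

theorem symmetricAlgebra_derivation_ext
    {d d' : Derivation ℂ (SymmetricAlgebra ℂ L) (SymmetricAlgebra ℂ L)}
    (h : ∀ y, d (SymmetricAlgebra.ι ℂ L y) = d' (SymmetricAlgebra.ι ℂ L y)) : d = d' := by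
  ext f
  induction f using SymmetricAlgebra.induction with
  | algebraMap r => simp
  | ι y => exact h y
  | mul a b ha hb => rw [Derivation.leibniz, Derivation.leibniz, ha, hb]
  | add a b ha hb => rw [map_add, map_add, ha, hb]

variable (L) in
/-- The Euler derivation, which multiplies a homogeneous element by its degree. -/
def eulerDerivation : Derivation ℂ (SymmetricAlgebra ℂ L) (SymmetricAlgebra ℂ L) :=
  symDerivation (SymmetricAlgebra.ι ℂ L)

/-- The derivation of the symmetric algebra that extends a linear form. -/
def formDerivation (φ : L →ₗ[ℂ] ℂ) :
    Derivation ℂ (SymmetricAlgebra ℂ L) (SymmetricAlgebra ℂ L) :=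
  symDerivation (Algebra.linearMap ℂ (SymmetricAlgebra ℂ L) ∘ₗ φ)

theorem eulerDerivation_ι (y : L) :
    eulerDerivation L (SymmetricAlgebra.ι ℂ L y) = SymmetricAlgebra.ι ℂ L y :=
  symDerivation_ι _ y

theorem formDerivation_ι (φ : L →ₗ[ℂ] ℂ) (y : L) :
    formDerivation φ (SymmetricAlgebra.ι ℂ L y) = algebraMap ℂ _ (φ y) :=
  symDerivation_ι _ y

/-- The commutator is a derivation that kills the generators, because each form derivation maps them
to scalars. -/
theorem formDerivation_comm (φ ψ : L →ₗ[ℂ] ℂ) (f : SymmetricAlgebra ℂ L) :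
    formDerivation φ (formDerivation ψ f) = formDerivation ψ (formDerivation φ f) := by
  have : ⁅formDerivation φ, formDerivation ψ⁆ = 0 :=
    symmetricAlgebra_derivation_ext fun y => by
      simp [Derivation.commutator_apply, formDerivation_ι]
  have h := DFunLike.congr_fun this f
  rw [Derivation.commutator_apply] at h
  exact sub_eq_zero.1 h

theorem eulerDerivation_formDerivation (φ : L →ₗ[ℂ] ℂ) (f : SymmetricAlgebra ℂ L) :
    eulerDerivation L (formDerivation φ f) =
      formDerivation φ (eulerDerivation L f) - formDerivation φ f := by
  have : ⁅eulerDerivation L, formDerivation φ⁆ = -formDerivation φ :=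
    symmetricAlgebra_derivation_ext fun y => by
      simp [Derivation.commutator_apply, formDerivation_ι, eulerDerivation_ι]
  have h := DFunLike.congr_fun this f
  rw [Derivation.commutator_apply, Derivation.neg_apply] at h
  rw [← sub_eq_zero] at h ⊢
  rw [← h]; abel

end SymmetricDerivation

/-! ### Coefficientwise derivations of power series, and `q d/dq`. -/

section PowerSeriesDerivation

variable {S : Type*} [CommRing S] [Algebra ℂ S]

/-- A derivation applied to the coefficients of power series. -/
def coeffDerivation (d : Derivation ℂ S S) : Derivation ℂ (PowerSeries S) (PowerSeries S) :=
  Derivation.mk'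
    { toFun := fun f => PowerSeries.mk fun m => d (PowerSeries.coeff m f)
      map_add' := fun f g => by ext m; simp
      map_smul' := fun c f => by ext m; simp }
    fun f g => by
      ext m
      simp only [LinearMap.coe_mk, AddHom.coe_mk, PowerSeries.coeff_mk, PowerSeries.coeff_mul,
        smul_eq_mul, map_add, map_sum, Derivation.leibniz, Finset.sum_add_distrib]
      congr 1
      rw [← Finset.Nat.sum_antidiagonal_swap]
      rfl

theorem coeff_coeffDerivation (d : Derivation ℂ S S) (f : PowerSeries S) (m : ℕ) :
    PowerSeries.coeff m (coeffDerivation d f) = d (PowerSeries.coeff m f) := by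
  simp [coeffDerivation]

theorem coeffDerivation_C (d : Derivation ℂ S S) (s : S) :
    coeffDerivation d (PowerSeries.C s) = PowerSeries.C (d s) := by
  ext m
  simp only [coeff_coeffDerivation, PowerSeries.coeff_C]
  split <;> simp

theorem coeffDerivation_X (d : Derivation ℂ S S) :
    coeffDerivation d (PowerSeries.X : PowerSeries S) = 0 := by
  ext m
  simp only [coeff_coeffDerivation, PowerSeries.coeff_X]
  split <;> simp

variable (S) in
/-- The derivation `q d/dq` of power series in `q`. -/
def degreeDerivation : Derivation ℂ (PowerSeries S) (PowerSeries S) :=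
  (PowerSeries.X : PowerSeries S) • (PowerSeries.derivative S).restrictScalars ℂ

theorem coeff_degreeDerivation (f : PowerSeries S) (m : ℕ) :
    PowerSeries.coeff m (degreeDerivation S f) = (m : S) * PowerSeries.coeff m f := by
  cases m with
  | zero => simp [degreeDerivation]
  | succ m =>
    simp [degreeDerivation, PowerSeries.coeff_succ_X_mul, PowerSeries.coeff_derivative]
    ring

theorem degreeDerivation_X :
    degreeDerivation S (PowerSeries.X : PowerSeries S) = PowerSeries.X := by
  simp [degreeDerivation]

theorem degreeDerivation_C (s : S) : degreeDerivation S (PowerSeries.C s) = 0 := by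
  simp [degreeDerivation]

end PowerSeriesDerivation

/-! ### The generating series of the `Φ_d` and its resolvent. -/

section OrthogonalSeries

attribute [local instance 100] LieRing.ofAssociativeRing

variable (n : ℕ)

/-- The linear form on `𝔰𝔬_n` given by a matrix entry. -/
def entryForm (a b : Fin n) : so n →ₗ[ℂ] ℂ where
  toFun y := (y : Matrix (Fin n) (Fin n) ℂ) a b
  map_add' _ _ := rfl
  map_smul' _ _ := rfl

theorem entryForm_apply (a b : Fin n) (y : so n) :
    entryForm n a b y = (y : Matrix (Fin n) (Fin n) ℂ) a b := rfl

theorem coe_F (i j : Fin n) : (F n i j : Matrix (Fin n) (Fin n) ℂ) = skewUnit ℂ i j := rfl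

theorem F_rev (i j : Fin n) : F n i.rev j.rev = -F n j i := by
  apply Subtype.ext
  simp [F]

/-- The derivation of `S(𝔰𝔬_n)` that extends a matrix entry. -/
def entryDerivation (a b : Fin n) :
    Derivation ℂ (SymmetricAlgebra ℂ (so n)) (SymmetricAlgebra ℂ (so n)) :=
  formDerivation (entryForm n a b)

/-- The transpose of the matrix `(F_{ij})`, over the formal power series. -/
def genMatrix : Matrix (Fin n) (Fin n) (PowerSeries (SymmetricAlgebra ℂ (so n))) :=
  Matrix.of fun i j => PowerSeries.C (SymmetricAlgebra.ι ℂ (so n) (F n j i))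

theorem antiT_genMatrix : antiT (genMatrix n) = -genMatrix n := by
  ext1 i j
  simp only [antiT_apply, genMatrix, Matrix.of_apply, F_rev, map_neg, Matrix.neg_apply]

/-- The transpose in `genMatrix` is chosen so that `∂_{ab}` produces `F_{ba}`, the partner of
`F_{ab}` in the sums above; it does not affect the determinant. -/
theorem genMatrix_map_entryDerivation (a b : Fin n) :
    (genMatrix n).map (coeffDerivation (entryDerivation n a b)) = skewUnit _ b a := by
  ext1 i j
  simp only [genMatrix, Matrix.map_apply, Matrix.of_apply, coeffDerivation_C, entryDerivation,
    formDerivation_ι, entryForm_apply, coe_F, skewUnit, Matrix.sub_apply, Matrix.single_apply,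
    map_sub, apply_ite, map_one, map_zero]
  grind [Fin.rev_rev]

theorem genMatrix_map_degreeDerivation : (genMatrix n).map (degreeDerivation _) = 0 := by
  ext1 i j
  simp [genMatrix, degreeDerivation_C]

theorem genMatrix_map_eulerDerivation :
    (genMatrix n).map (coeffDerivation (eulerDerivation _)) = genMatrix n := by
  ext1 i j
  simp [genMatrix, coeffDerivation_C, eulerDerivation_ι]

theorem detSeries_eq : detSeries n = (1 - (PowerSeries.X :
    PowerSeries (SymmetricAlgebra ℂ (so n))) • genMatrix n).det := by
  rw [detSeries, ← Matrix.det_transpose, Matrix.transpose_sub, Matrix.transpose_smul,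
    Matrix.transpose_one]
  rfl

/-- The generating series of the `Φ_d`. -/
def phiSeries : PowerSeries (SymmetricAlgebra ℂ (so n)) :=
  PowerSeries.invOfUnit (detSeries n) 1

theorem coeff_phiSeries (d : ℕ) : PowerSeries.coeff d (phiSeries n) = Phi n d := rfl

theorem det_mul_phiSeries : (1 - (PowerSeries.X :
    PowerSeries (SymmetricAlgebra ℂ (so n))) • genMatrix n).det * phiSeries n = 1 := by
  rw [← detSeries_eq, phiSeries, detSeries_mul_invOfUnit]

/-- The matrix `(1 - q N)⁻¹` for the transpose `N` of the matrix `(F_{ij})`. -/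
def genResolvent : Matrix (Fin n) (Fin n) (PowerSeries (SymmetricAlgebra ℂ (so n))) :=
  phiSeries n • (1 - (PowerSeries.X :
    PowerSeries (SymmetricAlgebra ℂ (so n))) • genMatrix n).adjugate

theorem genResolvent_mul : genResolvent n * (1 - (PowerSeries.X :
    PowerSeries (SymmetricAlgebra ℂ (so n))) • genMatrix n) = 1 := by
  rw [genResolvent, smul_mul_assoc, Matrix.adjugate_mul, smul_smul, mul_comm, det_mul_phiSeries,
    one_smul]

theorem trace_genResolvent_mul : (genResolvent n * ((PowerSeries.X :
    PowerSeries (SymmetricAlgebra ℂ (so n))) • genMatrix n)).trace =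
      (genResolvent n).trace - n := by
  rw [resolvent_mul_smul (genResolvent_mul n), Matrix.trace_sub, Matrix.trace_one, Fintype.card_fin]

theorem degreeDerivation_phiSeries :
    degreeDerivation _ (phiSeries n) = ((genResolvent n).trace - n) * phiSeries n := by
  rw [derivation_inv_det (det_mul_phiSeries n) (genResolvent_mul n),
    map_one_sub_smul_of_degree _ degreeDerivation_X (genMatrix_map_degreeDerivation n), mul_neg,
    Matrix.trace_neg, neg_neg, trace_genResolvent_mul]

theorem eulerDerivation_phiSeries :
    coeffDerivation (eulerDerivation _) (phiSeries n) =
      ((genResolvent n).trace - n) * phiSeries n := by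
  rw [derivation_inv_det (det_mul_phiSeries n) (genResolvent_mul n),
    map_one_sub_smul_of_const _ (coeffDerivation_X _), genMatrix_map_eulerDerivation, mul_neg,
    Matrix.trace_neg, neg_neg, trace_genResolvent_mul]

theorem entryDerivation_phiSeries (a b : Fin n) :
    coeffDerivation (entryDerivation n a b) (phiSeries n) =
      PowerSeries.X * phiSeries n * (skewUnit _ b a * genResolvent n).trace := by
  rw [derivation_inv_det (det_mul_phiSeries n) (genResolvent_mul n),
    map_one_sub_smul_of_const _ (coeffDerivation_X _), genMatrix_map_entryDerivation, mul_neg,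
    Matrix.trace_neg, neg_neg, mul_smul_comm, Matrix.trace_smul, Matrix.trace_mul_comm, smul_eq_mul]
  ring

theorem genResolvent_map_entryDerivation (a b : Fin n) :
    (genResolvent n).map (coeffDerivation (entryDerivation n a b)) =
      (PowerSeries.X : PowerSeries (SymmetricAlgebra ℂ (so n))) •
        (genResolvent n * skewUnit _ b a * genResolvent n) := by
  rw [map_derivation_inv (genResolvent_mul n), map_one_sub_smul_of_const _ (coeffDerivation_X _),
    genMatrix_map_entryDerivation, mul_neg, neg_mul, neg_neg, mul_smul_comm, smul_mul_assoc]

theorem genResolvent_map_degreeDerivation :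
    (genResolvent n).map (degreeDerivation _) =
      genResolvent n * genResolvent n - genResolvent n := by
  rw [map_derivation_inv (genResolvent_mul n), map_one_sub_smul_of_degree _ degreeDerivation_X
    (genMatrix_map_degreeDerivation n), mul_neg, neg_mul, neg_neg,
    resolvent_mul_smul (genResolvent_mul n), sub_mul, one_mul]

/-- `Φ_d` is homogeneous of degree `d`. -/
theorem eulerDerivation_Phi (d : ℕ) : eulerDerivation (so n) (Phi n d) = (d : ℂ) • Phi n d := by
  -- The Euler derivation and `q d/dq` both fix `qN`, hence agree on `H`: degree in `𝔤` equals
  -- degree in `q`.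
  rw [← coeff_phiSeries, ← coeff_coeffDerivation, eulerDerivation_phiSeries,
    ← degreeDerivation_phiSeries, coeff_degreeDerivation, Algebra.smul_def, map_natCast]

/-- A complex matrix, with its entries in another algebra. -/
def constMatrix (S : Type*) [CommRing S] [Algebra ℂ S] (y : Matrix (Fin n) (Fin n) ℂ) :
    Matrix (Fin n) (Fin n) S :=
  y.map (algebraMap ℂ S)

variable {n}

theorem constMatrix_map_derivation {S : Type*} [CommRing S] [Algebra ℂ S]
    (y : Matrix (Fin n) (Fin n) ℂ) (d : Derivation ℂ S S) : (constMatrix n S y).map d = 0 := by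
  ext1 i j
  simp [constMatrix]

theorem antiT_constMatrix (S : Type*) [CommRing S] [Algebra ℂ S] (y : so n) :
    antiT (constMatrix n S y) = -constMatrix n S y := by
  ext1 i j
  have := (mem_so_iff n (y : Matrix (Fin n) (Fin n) ℂ)).1 y.2 j.rev i.rev
  rw [Fin.rev_rev, Fin.rev_rev] at this
  simp only [antiT_apply, constMatrix, Matrix.map_apply, this, map_neg, Matrix.neg_apply]

theorem adDiv_third_power_phiSeries (y : so n) :
    let D := fun a b => coeffDerivation (entryDerivation n a b)
    let Y := phiSeries n • constMatrix n (PowerSeries (SymmetricAlgebra ℂ (so n))) y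
    adDiv D (adDiv D (adDiv D Y)) =
      (4 * (PowerSeries.X * PowerSeries.X) : PowerSeries (SymmetricAlgebra ℂ (so n))) •
        (((adDiv D Y).map (degreeDerivation _)).map (degreeDerivation _) +
        (2 * n - 1 : PowerSeries (SymmetricAlgebra ℂ (so n))) •
          (adDiv D Y).map (degreeDerivation _) +
        (n * (n - 1) : PowerSeries (SymmetricAlgebra ℂ (so n))) • adDiv D Y) :=
  adDiv_third_power (genResolvent_map_entryDerivation n) (entryDerivation_phiSeries n)
    (fun _ _ => coeffDerivation_X _) (fun _ _ => constMatrix_map_derivation _ _)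
    (antiT_constMatrix _ y) rfl
    (two_smul_resolvent_mul_antiT (antiT_genMatrix n) (genResolvent_mul n))
    (antiT_resolvent_comm (antiT_genMatrix n) (genResolvent_mul n)) _ degreeDerivation_X
    (degreeDerivation_phiSeries n) (genResolvent_map_degreeDerivation n)
    (constMatrix_map_derivation _ _)

theorem skewUnit_apply_algebraMap {S T : Type*} [CommRing S] [CommRing T] (f : S →+* T)
    (a b i j : Fin n) : skewUnit T a b i j = f (skewUnit S a b i j) := by
  simp [skewUnit, Matrix.single_apply, apply_ite f]

theorem adDiv_map_coeff {S : Type*} [CommRing S] [Algebra ℂ S]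
    (D : Fin n → Fin n → Derivation ℂ S S) (m : ℕ) (W : Matrix (Fin n) (Fin n) (PowerSeries S)) :
    (adDiv (fun a b => coeffDerivation (D a b)) W).map (PowerSeries.coeff m) =
      adDiv D (W.map (PowerSeries.coeff m)) := by
  ext1 i j
  simp only [adDiv, Matrix.map_apply, Matrix.sum_apply, Matrix.sub_apply, Matrix.mul_apply,
    map_sum, map_sub, skewUnit_apply_algebraMap (PowerSeries.C (R := S)), PowerSeries.coeff_C_mul,
    PowerSeries.coeff_mul_C, coeff_coeffDerivation]

theorem adDiv_third_power_Phi (y : so n) (m : ℕ) :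
    let Y := fun d => Phi n d • constMatrix n (SymmetricAlgebra ℂ (so n)) y
    adDiv (entryDerivation n) (adDiv (entryDerivation n) (adDiv (entryDerivation n) (Y (m + 2)))) =
      (4 * ((m + n) * (m + n - 1)) : ℂ) • adDiv (entryDerivation n) (Y m) := by
  intro Y
  have hY : ∀ d, (phiSeries n • constMatrix n (PowerSeries (SymmetricAlgebra ℂ (so n)))
      (y : Matrix (Fin n) (Fin n) ℂ)).map (PowerSeries.coeff d) = Y d := fun d => by
    ext1 i j
    simp only [Y, Matrix.map_apply, Matrix.smul_apply, constMatrix, smul_eq_mul,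
      PowerSeries.algebraMap_apply, PowerSeries.coeff_mul_C, coeff_phiSeries]
  have h := congrArg (fun A => A.map (PowerSeries.coeff (m + 2))) (adDiv_third_power_phiSeries y)
  simp only [adDiv_map_coeff (entryDerivation n), hY] at h
  rw [h]
  have h2 := adDiv_map_coeff (entryDerivation n) m (phiSeries n • constMatrix n
    (PowerSeries (SymmetricAlgebra ℂ (so n))) (y : Matrix (Fin n) (Fin n) ℂ))
  rw [hY] at h2
  rw [← h2]
  ext1 i j
  generalize adDiv (fun a b => coeffDerivation (entryDerivation n a b)) (phiSeries n •
    constMatrix n (PowerSeries (SymmetricAlgebra ℂ (so n))) (y : Matrix (Fin n) (Fin n) ℂ)) = Z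
  -- With the scalars written as constant series, coefficients can be extracted: `q²` shifts `m + 2`
  -- to `m`, `θ` becomes multiplication by `m`, and `m² + (2n-1)m + n(n-1) = (m+n)(m+n-1)`.
  have hc : (4 : PowerSeries (SymmetricAlgebra ℂ (so n))) =
      PowerSeries.C (4 : SymmetricAlgebra ℂ (so n)) := by rw [map_ofNat]
  have hc2 : (2 * n - 1 : PowerSeries (SymmetricAlgebra ℂ (so n))) =
      PowerSeries.C (2 * n - 1 : SymmetricAlgebra ℂ (so n)) := by
    rw [map_sub, map_mul, map_ofNat, map_natCast, map_one]
  have hc3 : (n * (n - 1) : PowerSeries (SymmetricAlgebra ℂ (so n))) =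
      PowerSeries.C (n * (n - 1) : SymmetricAlgebra ℂ (so n)) := by
    rw [map_mul, map_sub, map_natCast, map_one]
  rw [hc2, hc3, hc]
  simp only [Matrix.map_apply, Matrix.smul_apply, Matrix.add_apply, smul_eq_mul]
  simp only [mul_assoc, PowerSeries.coeff_C_mul, PowerSeries.coeff_succ_X_mul, map_add,
    coeff_degreeDerivation]
  simp only [Algebra.smul_def, map_mul, map_add, map_sub, map_natCast, map_one, map_ofNat]
  ring

end OrthogonalSeries

theorem sum_four_comm {ι M : Type*} [Fintype ι] [AddCommMonoid M] (f : ι → ι → ι → ι → M) :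
    ∑ a, ∑ b, ∑ c, ∑ d, f a b c d = ∑ c, ∑ d, ∑ a, ∑ b, f a b c d := by
  have h1 := Finset.sum_comm (s := Finset.univ) (t := Finset.univ)
    (f := fun p q : ι × ι => f p.1 p.2 q.1 q.2)
  simpa only [Fintype.sum_prod_type] using h1

/-! ### Symmetrisation and polarisation of monomials. -/

section Polarisation

variable (L : Type*) [AddCommGroup L] [Module ℂ L]

theorem tprod_succ (d : ℕ) (y : Fin (d + 1) → L) :
    TensorAlgebra.tprod ℂ L (d + 1) y =
      TensorAlgebra.ι ℂ (y 0) * TensorAlgebra.tprod ℂ L d (fun x => y x.succ) := by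
  rw [TensorAlgebra.tprod_apply, TensorAlgebra.tprod_apply, List.ofFn_succ, List.prod_cons]

theorem prod_erase_swap {S : Type*} [CommMonoid S] {d : ℕ} (g : Fin (d + 1) → S)
    (p : Fin (d + 1)) :
    ∏ j ∈ Finset.univ.erase p, g j = ∏ x : Fin d, g (Equiv.swap 0 p x.succ) := by
  symm
  refine Finset.prod_nbij (fun x => Equiv.swap 0 p x.succ) ?_ ?_ ?_ fun _ _ => rfl
  · intro x _
    simp only [Finset.mem_erase, Finset.mem_univ, and_true]
    intro h
    have := (Equiv.swap 0 p).injective (h.trans (Equiv.swap_apply_left 0 p).symm)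
    exact Fin.succ_ne_zero x this
  · intro x _ x' _ h
    exact Fin.succ_injective _ ((Equiv.swap 0 p).injective h)
  · intro j hj
    have hj' : j ≠ p := by simpa using hj
    have h0 : Equiv.swap 0 p j ≠ 0 := fun h => hj' (by
      have := congrArg (Equiv.swap 0 p) h
      rwa [Equiv.swap_apply_self, Equiv.swap_apply_left] at this)
    obtain ⟨x, hx⟩ := Fin.exists_succ_eq.2 h0
    refine ⟨x, Finset.mem_coe.2 (Finset.mem_univ x), ?_⟩
    simp only [hx, Equiv.swap_apply_self]

end Polarisation

section AdjointPolarisation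

variable (L : Type*) [LieRing L] [LieAlgebra ℂ L]

/-- Group the permutations by `p = σ(0)`: those with a given `p` symmetrise the remaining `d`
factors, and `(d+1)! = (d+1) d!`. -/
theorem adHead_symmetrisation_prod (d : ℕ) (y : Fin (d + 1) → L) :
    ((d + 1 : ℕ) : ℂ) • adHead L (symmetrisation L (∏ i, SymmetricAlgebra.ι ℂ L (y i))) =
      ∑ p, LieAlgebra.ad ℂ L (y p) ⊗ₜ[ℂ]
        symmetrisation L (∏ j ∈ Finset.univ.erase p, SymmetricAlgebra.ι ℂ L (y j)) := by
  rw [symmetrisation_prod, map_smul, map_sum, smul_smul, Nat.factorial_succ, Nat.cast_mul, mul_inv,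
    mul_inv_cancel_left₀ (by exact_mod_cast Nat.succ_ne_zero d),
    ← Equiv.sum_comp Equiv.Perm.decomposeFin.symm, Fintype.sum_prod_type, Finset.smul_sum]
  refine Finset.sum_congr rfl fun p _ => ?_
  rw [prod_erase_swap, symmetrisation_prod L d fun x => y (Equiv.swap 0 p x.succ),
    TensorProduct.tmul_smul, TensorProduct.tmul_sum]
  congr 1
  refine Finset.sum_congr rfl fun τ _ => ?_
  rw [tprod_succ, adHead_ι_mul]
  simp only [Function.comp_apply, Equiv.Perm.decomposeFin_symm_apply_zero,
    Equiv.Perm.decomposeFin_symm_apply_succ]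
  rfl

theorem span_symmetricAlgebra_prod (f : SymmetricAlgebra ℂ L) :
    f ∈ Submodule.span ℂ {s : SymmetricAlgebra ℂ L |
      ∃ (d : ℕ) (y : Fin d → L), s = ∏ i, SymmetricAlgebra.ι ℂ L (y i)} := by
  obtain ⟨t, rfl⟩ := SymmetricAlgebra.algHom_surjective ℂ L f
  have ht : t ∈ Submodule.span ℂ
      {t : TensorAlgebra ℂ L | ∃ l : List L, t = (l.map (TensorAlgebra.ι ℂ)).prod} := by
    rw [span_prod]; trivial
  induction ht using Submodule.span_induction with
  | mem x hx =>
    obtain ⟨l, rfl⟩ := hx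
    refine Submodule.subset_span ⟨l.length, l.get, ?_⟩
    rw [map_list_prod, List.map_map, ← List.prod_ofFn]
    congr 1
    apply List.ext_getElem <;> simp [SymmetricAlgebra.ι]
  | zero => simp
  | add x y _ _ h h' => rw [map_add]; exact Submodule.add_mem _ h h'
  | smul r x _ h => rw [map_smul]; exact Submodule.smul_mem _ r h

theorem eulerDerivation_prod (d : ℕ) (y : Fin d → L) :
    eulerDerivation L (∏ i, SymmetricAlgebra.ι ℂ L (y i)) =
      (d : ℂ) • ∏ i, SymmetricAlgebra.ι ℂ L (y i) := by
  rw [derivation_prod]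
  simp only [eulerDerivation_ι]
  rw [Finset.sum_congr rfl fun i hi => Finset.mul_prod_erase Finset.univ
    (fun i => SymmetricAlgebra.ι ℂ L (y i)) hi, Finset.sum_const, Finset.card_univ, Fintype.card_fin, Nat.cast_smul_eq_nsmul]

end AdjointPolarisation

/-! ### Polarisation operators on `𝔤𝔩(𝔰𝔬_n) ⊗ S(𝔰𝔬_n)`. -/

section Orthogonal

attribute [local instance 100] LieRing.ofAssociativeRing

variable (n : ℕ)

/-- The factor 2 reflects that `(a, b)` and `(b', a')` contribute the same term, both the entry and
`F` changing sign. -/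
theorem sum_entryForm_smul_F (y : so n) :
    ∑ a, ∑ b, entryForm n a b y • F n a b = (2 : ℂ) • y := by
  apply Subtype.ext
  have hy : antiT (y : Matrix (Fin n) (Fin n) ℂ) = -y := by
    ext1 i j
    have := (mem_so_iff n (y : Matrix (Fin n) (Fin n) ℂ)).1 y.2 j.rev i.rev
    rwa [Fin.rev_rev, Fin.rev_rev] at this
  have h1 : ∀ a b, (skewUnit ℂ b a * (y : Matrix (Fin n) (Fin n) ℂ)).trace =
      2 * entryForm n a b y := fun a b => by
    have h2 := (mem_so_iff n (y : Matrix (Fin n) (Fin n) ℂ)).1 y.2 a b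
    simp only [skewUnit, sub_mul, Matrix.trace_sub, Matrix.trace_single_mul, entryForm_apply]
    linear_combination -h2
  have h3 := sum_skewUnit_trace (y : Matrix (Fin n) (Fin n) ℂ)
  simp only [h1, hy, mul_smul, ← Finset.smul_sum] at h3
  have h4 := smul_right_injective (Matrix (Fin n) (Fin n) ℂ) (two_ne_zero (α := ℂ)) h3
  simp only [AddSubmonoidClass.coe_finsetSum, SetLike.val_smul, coe_F]
  rw [h4]
  module

theorem sum_ad_F (y : so n) :
    ∑ a, ∑ b, entryForm n a b y • LieAlgebra.ad ℂ (so n) (F n a b) =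
      (2 : ℂ) • LieAlgebra.ad ℂ (so n) y := by
  rw [← map_smul, ← sum_entryForm_smul_F]
  simp only [map_sum, map_smul]

/-- The Euler derivation supplies the degree factor of `adHead_symmetrisation_prod`, which makes the
identity linear in `f`, so monomials suffice. -/
theorem adHead_symmetrisation_euler (f : SymmetricAlgebra ℂ (so n)) :
    (2 : ℂ) • adHead (so n) (symmetrisation (so n) (eulerDerivation (so n) f)) =
      ∑ a, ∑ b, LieAlgebra.ad ℂ (so n) (F n a b) ⊗ₜ[ℂ]
        symmetrisation (so n) (entryDerivation n a b f) := by
  induction span_symmetricAlgebra_prod (so n) f using Submodule.span_induction with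
  | mem x hx =>
    obtain ⟨d, y, rfl⟩ := hx
    cases d with
    | zero => simp
    | succ d =>
      rw [eulerDerivation_prod, map_smul, map_smul, adHead_symmetrisation_prod]
      have h1 : ∀ a b, entryDerivation n a b (∏ i, SymmetricAlgebra.ι ℂ (so n) (y i)) =
          ∑ p, entryForm n a b (y p) •
            ∏ j ∈ Finset.univ.erase p, SymmetricAlgebra.ι ℂ (so n) (y j) := fun a b => by
        rw [derivation_prod]
        simp only [entryDerivation, formDerivation_ι, Algebra.smul_def]
      simp only [h1, map_sum, map_smul, TensorProduct.tmul_sum, TensorProduct.tmul_smul,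
        TensorProduct.smul_tmul', Finset.smul_sum]
      rw [Finset.sum_congr rfl fun a _ => Finset.sum_comm, Finset.sum_comm]
      refine Finset.sum_congr rfl fun p _ => ?_
      rw [← sum_ad_F]
      simp only [TensorProduct.sum_tmul]
  | zero => simp
  | add x y _ _ h h' =>
    simp only [map_add, smul_add, h, h', TensorProduct.tmul_add, Finset.sum_add_distrib]
  | smul r x _ h =>
    simp only [map_smul, Derivation.map_smul, TensorProduct.tmul_smul, smul_comm (2 : ℂ) r, h,
      Finset.smul_sum]

/-- The operator `a ⊗ f ↦ ∑ a ad(F_{ab}) ⊗ ∂_{ab} f`. -/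
def rightPolarisation : Module.End ℂ (Module.End ℂ (so n) ⊗[ℂ] SymmetricAlgebra ℂ (so n)) :=
  ∑ a, ∑ b, TensorProduct.map (LinearMap.mulRight ℂ (LieAlgebra.ad ℂ (so n) (F n a b)))
    (entryDerivation n a b).toLinearMap

/-- The operator `a ⊗ f ↦ ∑ ad(F_{ab}) a ⊗ ∂_{ab} f`. -/
def leftPolarisation : Module.End ℂ (Module.End ℂ (so n) ⊗[ℂ] SymmetricAlgebra ℂ (so n)) :=
  ∑ a, ∑ b, TensorProduct.map (LinearMap.mulLeft ℂ (LieAlgebra.ad ℂ (so n) (F n a b)))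
    (entryDerivation n a b).toLinearMap

theorem rightPolarisation_tmul (x : Module.End ℂ (so n)) (f : SymmetricAlgebra ℂ (so n)) :
    rightPolarisation n (x ⊗ₜ f) =
      ∑ a, ∑ b, (x * LieAlgebra.ad ℂ (so n) (F n a b)) ⊗ₜ entryDerivation n a b f := by
  simp [rightPolarisation]

theorem leftPolarisation_tmul (x : Module.End ℂ (so n)) (f : SymmetricAlgebra ℂ (so n)) :
    leftPolarisation n (x ⊗ₜ f) =
      ∑ a, ∑ b, (LieAlgebra.ad ℂ (so n) (F n a b) * x) ⊗ₜ entryDerivation n a b f := by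
  simp [leftPolarisation]

theorem rightPolarisation_one_tmul (f : SymmetricAlgebra ℂ (so n)) :
    rightPolarisation n (1 ⊗ₜ f) = leftPolarisation n (1 ⊗ₜ f) := by
  rw [rightPolarisation_tmul, leftPolarisation_tmul]
  simp only [one_mul, mul_one]

theorem rightPolarisation_leftPolarisation
    (z : Module.End ℂ (so n) ⊗[ℂ] SymmetricAlgebra ℂ (so n)) :
    rightPolarisation n (leftPolarisation n z) = leftPolarisation n (rightPolarisation n z) := by
  induction z using TensorProduct.induction_on with
  | zero => simp
  | add x y hx hy => rw [map_add, map_add, hx, hy, map_add, map_add]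
  | tmul x f =>
    simp only [rightPolarisation_tmul, leftPolarisation_tmul, map_sum]
    rw [sum_four_comm]
    refine Finset.sum_congr rfl fun a _ => Finset.sum_congr rfl fun b _ =>
      Finset.sum_congr rfl fun c _ => Finset.sum_congr rfl fun d _ => ?_
    rw [mul_assoc, entryDerivation, entryDerivation, formDerivation_comm]

end Orthogonal

/-! ### From the matrix identity back to `𝗆` and the embedding. -/

section Comparison

attribute [local instance 100] LieRing.ofAssociativeRing

variable (n : ℕ)

/-- Evaluation of the operator part of an element of `𝔤𝔩(𝔰𝔬_n) ⊗ S(𝔰𝔬_n)` at `y`, as a matrix. -/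
def evalMatrix (y : so n) : Module.End ℂ (so n) ⊗[ℂ] SymmetricAlgebra ℂ (so n) →ₗ[ℂ]
    Matrix (Fin n) (Fin n) (SymmetricAlgebra ℂ (so n)) :=
  TensorProduct.lift
    { toFun := fun x =>
        { toFun := fun f => f • constMatrix n _ (x y : Matrix (Fin n) (Fin n) ℂ)
          map_add' := fun f g => add_smul _ _ _
          map_smul' := fun c f => smul_assoc c f _ }
      map_add' := fun x x' => by
        ext f i j
        simp [constMatrix, mul_add]
      map_smul' := fun c x => by
        ext f i j
        have h : ((c • x) y : so n) = c • x y := rfl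
        have h' : ((c • x y : so n) : Matrix (Fin n) (Fin n) ℂ) i j =
            c * (x y : Matrix (Fin n) (Fin n) ℂ) i j := rfl
        simp only [LinearMap.coe_mk, AddHom.coe_mk, LinearMap.smul_apply, RingHom.id_apply,
          Matrix.smul_apply, constMatrix, Matrix.map_apply, h, h', smul_eq_mul, map_mul]
        rw [Algebra.smul_def]
        ring }

theorem evalMatrix_tmul (y : so n) (x : Module.End ℂ (so n)) (f : SymmetricAlgebra ℂ (so n)) :
    evalMatrix n y (x ⊗ₜ f) = f • constMatrix n _ (x y : Matrix (Fin n) (Fin n) ℂ) := rfl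

theorem constMatrix_ad_F {S : Type*} [CommRing S] [Algebra ℂ S] (a b : Fin n) (y : so n) :
    constMatrix n S ((LieAlgebra.ad ℂ (so n) (F n a b) y : so n) : Matrix (Fin n) (Fin n) ℂ) =
      skewUnit S a b * constMatrix n S y - constMatrix n S y * skewUnit S a b := by
  have h1 : ((LieAlgebra.ad ℂ (so n) (F n a b) y : so n) : Matrix (Fin n) (Fin n) ℂ) =
      skewUnit ℂ a b * (y : Matrix (Fin n) (Fin n) ℂ) - y * skewUnit ℂ a b := rfl
  have h2 : skewUnit S a b = (skewUnit ℂ a b).map (algebraMap ℂ S) := by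
    ext1 i j
    exact skewUnit_apply_algebraMap (algebraMap ℂ S) a b i j
  rw [h1, h2]
  ext1 i j
  simp [constMatrix, Matrix.mul_apply]

/-- Left multiplication is the side compatible with evaluation: `(ad(F_{ab}) x)(y) = [F_{ab},
x(y)]`, and the entries of `x(y)` are constants for `∂_{ab}`. -/
theorem evalMatrix_leftPolarisation (y : so n)
    (z : Module.End ℂ (so n) ⊗[ℂ] SymmetricAlgebra ℂ (so n)) :
    evalMatrix n y (leftPolarisation n z) = adDiv (entryDerivation n) (evalMatrix n y z) := by
  induction z using TensorProduct.induction_on with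
  | zero => simp [adDiv]
  | add x x' hx hx' => rw [map_add, map_add, hx, hx', map_add, adDiv_add]
  | tmul x f =>
    simp only [leftPolarisation_tmul, map_sum, evalMatrix_tmul, adDiv, map_derivation_smul,
      constMatrix_map_derivation, smul_zero, add_zero, Module.End.mul_apply, constMatrix_ad_F,
      smul_sub, mul_smul_comm, smul_mul_assoc]

/-- The coordinates of the values of an endomorphism of `𝔰𝔬_n` at the elements `F_{cd}`. -/
def endCoordinates : Module.End ℂ (so n) →ₗ[ℂ] (((Fin n × Fin n) × (Fin n × Fin n)) → ℂ) :=
  LinearMap.pi fun p => entryForm n p.2.1 p.2.2 ∘ₗ LinearMap.applyₗ (F n p.1.1 p.1.2)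

theorem endCoordinates_injective : Function.Injective (endCoordinates n) := by
  rw [← LinearMap.ker_eq_bot, LinearMap.ker_eq_bot']
  intro x hx
  have h1 : ∀ a b, x (F n a b) = 0 := fun a b => by
    apply Subtype.ext
    ext i j
    exact congrFun hx ((a, b), (i, j))
  ext1 y
  have h2 := congrArg x (sum_entryForm_smul_F n y)
  simp only [map_sum, map_smul, h1, smul_zero, Finset.sum_const_zero] at h2
  simpa using h2.symm

/-- An endomorphism is determined by its matrix coordinates at the `F_{cd}`. This injection survives
tensoring with the flat module `S(𝔰𝔬_n)`, and the resulting coordinates are entries of `evalMatrix`.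
-/
theorem ext_evalMatrix {z z' : Module.End ℂ (so n) ⊗[ℂ] SymmetricAlgebra ℂ (so n)}
    (h : ∀ y, evalMatrix n y z = evalMatrix n y z') : z = z' := by
  apply Module.Flat.rTensor_preserves_injective_linearMap (M := SymmetricAlgebra ℂ (so n)) _
    (endCoordinates_injective n)
  apply (TensorProduct.comm ℂ _ _).injective
  apply (TensorProduct.piScalarRight ℂ ℂ _ _).injective
  have key : ∀ (p : (Fin n × Fin n) × (Fin n × Fin n)) z,
      TensorProduct.piScalarRight ℂ ℂ (SymmetricAlgebra ℂ (so n)) _ (TensorProduct.comm ℂ _ _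
        (LinearMap.rTensor (SymmetricAlgebra ℂ (so n)) (endCoordinates n) z)) p =
      evalMatrix n (F n p.1.1 p.1.2) z p.2.1 p.2.2 := by
    intro p z
    induction z using TensorProduct.induction_on with
    | zero => simp
    | add x x' hx hx' => simp only [map_add, Pi.add_apply, hx, hx', Matrix.add_apply]
    | tmul x f =>
      simp only [LinearMap.rTensor_tmul, TensorProduct.comm_tmul, evalMatrix_tmul,
        TensorProduct.piScalarRight_apply, TensorProduct.piScalarRightHom_tmul, Matrix.smul_apply,
        constMatrix, Matrix.map_apply, smul_eq_mul, Algebra.smul_def]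
      exact mul_comm _ _
  funext p
  rw [key, key, h]

theorem leftPolarisation_third_power_Phi (m : ℕ) :
    leftPolarisation n (leftPolarisation n (leftPolarisation n (1 ⊗ₜ Phi n (m + 2)))) =
      (4 * ((m + n) * (m + n - 1)) : ℂ) • leftPolarisation n (1 ⊗ₜ Phi n m) := by
  apply ext_evalMatrix
  intro y
  simp only [map_smul, evalMatrix_leftPolarisation, evalMatrix_tmul, Module.End.one_apply]
  exact adDiv_third_power_Phi y m

/-- Convert the innermost operator, which acts on `1 ⊗ f`, to a left one, move it outwards past the
remaining right operators, and repeat. -/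
theorem rightPolarisation_third_power_one_tmul (f : SymmetricAlgebra ℂ (so n)) :
    rightPolarisation n (rightPolarisation n (rightPolarisation n (1 ⊗ₜ f))) =
      leftPolarisation n (leftPolarisation n (leftPolarisation n (1 ⊗ₜ f))) := by
  rw [rightPolarisation_one_tmul, rightPolarisation_leftPolarisation,
    rightPolarisation_leftPolarisation, rightPolarisation_one_tmul,
    rightPolarisation_leftPolarisation, rightPolarisation_one_tmul]

/-- The map `a ⊗ (y₁ ⊗ ⋯ ⊗ y_d) ↦ a ad(y₁) ⊗ (y₂ ⊗ ⋯ ⊗ y_d)`. -/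
def absorb : Module.End ℂ (so n) ⊗[ℂ] TensorAlgebra ℂ (so n) →ₗ[ℂ]
    Module.End ℂ (so n) ⊗[ℂ] TensorAlgebra ℂ (so n) :=
  LinearMap.rTensor (TensorAlgebra ℂ (so n)) (LinearMap.mul' ℂ (Module.End ℂ (so n))) ∘ₗ
    (TensorProduct.assoc ℂ (Module.End ℂ (so n)) (Module.End ℂ (so n))
      (TensorAlgebra ℂ (so n))).symm.toLinearMap ∘ₗ
        LinearMap.lTensor (Module.End ℂ (so n)) (adHead (so n))

theorem absorb_tmul (x : Module.End ℂ (so n)) (t : TensorAlgebra ℂ (so n)) :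
    absorb n (x ⊗ₜ t) = LinearMap.rTensor (TensorAlgebra ℂ (so n)) (LinearMap.mulLeft ℂ x)
      (adHead (so n) t) := by
  have h : (LinearMap.rTensor (TensorAlgebra ℂ (so n)) (LinearMap.mul' ℂ (Module.End ℂ (so n))) ∘ₗ
      (TensorProduct.assoc ℂ (Module.End ℂ (so n)) (Module.End ℂ (so n))
        (TensorAlgebra ℂ (so n))).symm.toLinearMap) ∘ₗ TensorProduct.mk ℂ _ _ x =
      LinearMap.rTensor (TensorAlgebra ℂ (so n)) (LinearMap.mulLeft ℂ x) :=
    TensorProduct.ext' fun _ _ => rfl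
  exact LinearMap.congr_fun h (adHead (so n) t)

theorem absorb_one_tmul (t : TensorAlgebra ℂ (so n)) :
    absorb n (1 ⊗ₜ t) = adHead (so n) t := by
  rw [absorb_tmul, LinearMap.mulLeft_one, LinearMap.rTensor_id, LinearMap.id_apply]

/-- The symmetrisation map on the second tensor factor. -/
abbrev tensorSymmetrisation : Module.End ℂ (so n) ⊗[ℂ] SymmetricAlgebra ℂ (so n) →ₗ[ℂ]
    Module.End ℂ (so n) ⊗[ℂ] TensorAlgebra ℂ (so n) :=
  LinearMap.lTensor _ (symmetrisation (so n))

/-- The Euler derivation on the second tensor factor. -/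
abbrev tensorEuler : Module.End ℂ (Module.End ℂ (so n) ⊗[ℂ] SymmetricAlgebra ℂ (so n)) :=
  LinearMap.lTensor _ (eulerDerivation (so n)).toLinearMap

theorem absorb_tensorSymmetrisation
    (z : Module.End ℂ (so n) ⊗[ℂ] SymmetricAlgebra ℂ (so n)) :
    (2 : ℂ) • absorb n (tensorSymmetrisation n (tensorEuler n z)) =
      tensorSymmetrisation n (rightPolarisation n z) := by
  induction z using TensorProduct.induction_on with
  | zero => simp
  | add x x' h h' => simp only [map_add, smul_add, h, h']
  | tmul x f =>
    have h := adHead_symmetrisation_euler n f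
    simp only [LinearMap.lTensor_tmul, absorb_tmul, rightPolarisation_tmul, map_sum]
    rw [← map_smul]
    erw [h]
    simp

theorem tensorEuler_rightPolarisation
    (z : Module.End ℂ (so n) ⊗[ℂ] SymmetricAlgebra ℂ (so n)) :
    tensorEuler n (rightPolarisation n z) =
      rightPolarisation n (tensorEuler n z) - rightPolarisation n z := by
  induction z using TensorProduct.induction_on with
  | zero => simp
  | add x x' h h' => simp only [map_add, h, h']; abel
  | tmul x f =>
    have h : ∀ a b, (eulerDerivation (so n)).toLinearMap (entryDerivation n a b f) =
        entryDerivation n a b ((eulerDerivation (so n)).toLinearMap f) - entryDerivation n a b f :=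
      fun a b => eulerDerivation_formDerivation _ f
    simp only [LinearMap.lTensor_tmul, rightPolarisation_tmul, map_sum, h,
      TensorProduct.tmul_sub, Finset.sum_sub_distrib]

theorem tensorEuler_rightPolarisation_of_eigen {c : ℂ}
    {z : Module.End ℂ (so n) ⊗[ℂ] SymmetricAlgebra ℂ (so n)} (hz : tensorEuler n z = c • z) :
    tensorEuler n (rightPolarisation n z) = (c - 1) • rightPolarisation n z := by
  rw [tensorEuler_rightPolarisation, hz, map_smul]
  module

theorem absorb_of_eigen {c : ℂ}
    {z : Module.End ℂ (so n) ⊗[ℂ] SymmetricAlgebra ℂ (so n)} (hz : tensorEuler n z = c • z) :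
    (2 * c) • absorb n (tensorSymmetrisation n z) =
      tensorSymmetrisation n (rightPolarisation n z) := by
  rw [← absorb_tensorSymmetrisation, hz, map_smul, map_smul, smul_smul]

theorem tensorEuler_one_tmul_Phi (d : ℕ) :
    tensorEuler n (1 ⊗ₜ Phi n d) = (d : ℂ) • ((1 : Module.End ℂ (so n)) ⊗ₜ[ℂ] Phi n d) := by
  rw [← TensorProduct.tmul_smul, ← eulerDerivation_Phi]
  rfl

theorem smul_symEmbedding_Phi (d : ℕ) :
    (2 * d : ℂ) • symEmbedding (so n) (Phi n d) =
      tensorSymmetrisation n (rightPolarisation n (1 ⊗ₜ Phi n d)) := by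
  rw [← absorb_of_eigen n (tensorEuler_one_tmul_Phi n d), LinearMap.lTensor_tmul, absorb_one_tmul]
  rfl

theorem smul_mMap_Phi (d : ℕ) :
    (8 * (d * (d - 1) * (d - 2)) : ℂ) • mMap (so n) (Phi n d) =
      tensorSymmetrisation n
        (rightPolarisation n (rightPolarisation n (rightPolarisation n (1 ⊗ₜ Phi n d)))) := by
  have h0 := tensorEuler_one_tmul_Phi n d
  have h1 := tensorEuler_rightPolarisation_of_eigen n h0
  have h2 := tensorEuler_rightPolarisation_of_eigen n h1
  -- `mTensor` is an iterated `absorb` started at `1 ⊗ t`. Each absorption costs twice the current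
  -- degree, `d`, `d - 1`, `d - 2`, whence the factor 8.
  have e : mMap (so n) (Phi n d) =
      absorb n (absorb n (absorb n (tensorSymmetrisation n (1 ⊗ₜ Phi n d)))) := rfl
  rw [← absorb_of_eigen n h2, ← absorb_of_eigen n h1, ← absorb_of_eigen n h0, e]
  simp only [map_smul, smul_smul]
  congr 1
  ring

end Comparison

end SymmetrisationMap

end

/-! ### Comparison of the constants. -/

open SymmetrisationMap in
theorem mainTheorem8 (n k : ℕ) (hn : 7 ≤ n) (hk : 2 ≤ k) :
    mMap (so n) (Phi n (2 * k)) =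
      (((n.choose 2 : ℂ) + 2 * (n : ℂ) * ((k : ℂ) - 1) + ((k : ℂ) - 1) * (2 * (k : ℂ) - 3)) /
          ((k : ℂ) * (2 * (k : ℂ) - 1))) •
        symEmbedding (so n) (Phi n (2 * k - 2)) := by
  obtain ⟨j, rfl⟩ : ∃ j, k = j + 2 := ⟨k - 2, by omega⟩
  have h1 := smul_mMap_Phi n (2 * (j + 2))
  have h2 := smul_symEmbedding_Phi n (2 * (j + 2) - 2)
  have e : 2 * (j + 2) = (2 * (j + 2) - 2) + 2 := by omega
  have e' : ((2 * (j + 2) - 2 : ℕ) : ℂ) = 2 * j + 2 := by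
    rw [show 2 * (j + 2) - 2 = 2 * j + 2 by omega]; push_cast; ring
  have h3 := leftPolarisation_third_power_Phi n (2 * (j + 2) - 2)
  rw [← e] at h3
  rw [rightPolarisation_third_power_one_tmul, h3, map_smul, ← rightPolarisation_one_tmul, ← h2,
    smul_smul, e'] at h1
  have hc : (8 * (((2 * (j + 2) : ℕ) : ℂ) * (((2 * (j + 2) : ℕ) : ℂ) - 1) *
      (((2 * (j + 2) : ℕ) : ℂ) - 2)) : ℂ) =
      8 * ((2 * j + 4) * (2 * j + 3) * (2 * j + 2)) := by
    push_cast; ring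
  -- With `k = j + 2`, these are the degree factors `2k`, `2k - 1`, `2k - 2` to be divided out.
  have n1 : (2 * j + 4 : ℂ) ≠ 0 := by exact_mod_cast Nat.succ_ne_zero (2 * j + 3)
  have n2 : (2 * j + 3 : ℂ) ≠ 0 := by exact_mod_cast Nat.succ_ne_zero (2 * j + 2)
  have n3 : (2 * j + 2 : ℂ) ≠ 0 := by exact_mod_cast Nat.succ_ne_zero (2 * j + 1)
  have n4 : (j + 2 : ℂ) ≠ 0 := by exact_mod_cast Nat.succ_ne_zero (j + 1)
  have n0 : (8 * ((2 * j + 4) * (2 * j + 3) * (2 * j + 2)) : ℂ) ≠ 0 := by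
    simp [n1, n2, n3]
  rw [hc] at h1
  rw [← inv_smul_smul₀ n0 (mMap (so n) (Phi n (2 * (j + 2)))), h1, smul_smul]
  congr 1
  -- What remains is `(n+2k-2)(n+2k-3)/2 = binom(n,2) + 2n(k-1) + (k-1)(2k-3)`.
  rw [Nat.cast_choose_two]
  push_cast
  have n5 : (2 * (j + 2) - 1 : ℂ) ≠ 0 := by
    rw [show (2 * (j + 2) - 1 : ℂ) = 2 * j + 3 by ring]; exact n2
  rw [inv_mul_eq_div, div_eq_div_iff n0 (mul_ne_zero n4 n5)]
  ring
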